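/- Let $(X,g)$ be a closed, simply connected, smooth Riemannian $4$-manifold with a spin structure, i.e. a principal $Spin(4)$-bundle $P\to X$ lifting the bundle of oriented orthonormal frames, where $Spin(4)=SU(2)\times SU(2)\ni(p_-,p_+)$ and $SU(2)$ is the group of unit quaternions. Let $V=\mathbb H$, $W^+=\mathbb H$, $W^-=\mathbb H$ carry the $Spin(4)$-actions $v\mapsto p_-vp_+^{-1}$, $\psi\mapsto p_+\psi$, $\phi\mapsto p_-\phi$. Then $TX\cong T^*X=P\times_{Spin(4)}V$ and $\mathfrak s^\pm_{1/2}=P\times_{Spin(4)}W^\pm$; complex scalars act on spinors by quaternionic multiplication from the right, and Clifford multiplication $\rho$ is given by $\rho(v)\psi=v\psi$ on $W^+$ and $\rho(v)\phi=-\bar v\phi$ on $W^-$. Let $\mathfrak s^\pm_{3/2}\subset TX\otimes\mathfrak s^\pm_{1/2}$ be the kernel of the contraction $\rho:TX\otimes\mathfrak s^\pm_{1/2}\to\mathfrak s^\mp_{1/2}$, $\sum_\alpha e_\alpha\otimes\psi_\alpha\mapsto\sum_\alpha\rho(e_\alpha)\psi_\alpha$. Let $\pi^-(\phi)=\phi+\tfrac14\sum_\alpha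 e_\alpha\otimes\rho(e_\alpha)\rho(\phi)$ be the orthogonal projection of $TX\otimes\mathfrak s^-_{1/2}$ onto $\mathfrak s^-_{3/2}$. Let $\mathcal D^+$ be the Dirac operator $\Gamma(TX\otimes\mathfrak s^+_{1/2})\to\Gamma(TX\otimes\mathfrak s^-_{1/2})$ of the connection induced by the Levi-Civita connection, and let $Q^+=\pi^-\circ\mathcal D^+|_{\Gamma(\mathfrak s^+_{3/2})}$ be the Rarita-Schwinger operator. For $\psi=\sum_\alpha e_\alpha\otimes\psi_\alpha$ let $\mu(\psi)=\psi\psi^*-\tfrac12\operatorname{tr}(\psi\psi^*)1$, where $\psi\psi^*=\sum_\alpha\psi_\alpha\psi_\alpha^*\in\operatorname{End}_{\mathbb C}(\mathfrak s^+_{1/2})$, and let $\rho^{-1}$ be the inverse of the isomorphism $\rho:i\Lambda^+T^*X\to i\mathfrak{su}(\mathfrak s^+_{1/2})$. Put, with smooth sections and forms, $$\mathcal C=\Gamma(\mathfrak s^+_{3/2})\oplus i\Omega^1(X),\qquad \mathcal R=\Gamma(\mathfrak s^-_{3/2})\oplus i\Omega^0(X)\oplus i\Omega^+(X).$$ Let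 $Pin(2)=S^1\sqcup jS^1\subset SU(2)$ act on $\Gamma(\mathfrak s^\pm_{3/2})$ by quaternionic right multiplication on the spinors, $\sum_\alpha e_\alpha\otimes\psi_\alpha\mapsto\sum_\alpha e_\alpha\otimes\psi_\alpha p^{-1}$, and on $i\Omega^0(X)$, $i\Omega^1(X)$, $i\Omega^+(X)$ through the character that is $1$ on $S^1$ and $-1$ on $jS^1$. Then the formula $$\mathcal F(\psi,a)=\bigl(Q^+\psi+\pi^-(a\cdot\psi),\ d^*a,\ d^+a-\rho^{-1}(\mu(\psi))\bigr),$$ read in every local spin frame, gives a well-defined map $\mathcal F:\mathcal C\to\mathcal R$, and $\mathcal F$ is $Pin(2)$-equivariant: $\mathcal F(p\cdot c)=p\cdot\mathcal F(c)$ for all $p\in Pin(2)$ and $c\in\mathcal C$. -/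

import Mathlib

open scoped Manifold ContDiff Quaternion Matrix

noncomputable section

namespace RSSW

/-! ### Quaternionic linear algebra: the modules `V = ₋ℍ₊`, `W⁺ = ₊ℍ`, `W⁻ = ₋ℍ` -/

/-- `Spin(4) = SU(2) × SU(2)`, with `SU(2)` the unit quaternions. An element is written
`(p₋, p₊)`. -/
abbrev Spin4 : Type := unitary ℍ[ℝ] × unitary ℍ[ℝ]

/-- The quaternion `i`. -/
def quatI : ℍ[ℝ] := ⟨0, 1, 0, 0⟩

/-- The quaternion `j`. -/
def quatJ : ℍ[ℝ] := ⟨0, 0, 1, 0⟩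

/-- The quaternion `k`. -/
def quatK : ℍ[ℝ] := ⟨0, 0, 0, 1⟩

theorem quatI_parts : quatI.re = 0 ∧ quatI.imI = 1 ∧ quatI.imJ = 0 ∧ quatI.imK = 0 :=
  ⟨rfl, rfl, rfl, rfl⟩

theorem quatJ_parts : quatJ.re = 0 ∧ quatJ.imI = 0 ∧ quatJ.imJ = 1 ∧ quatJ.imK = 0 :=
  ⟨rfl, rfl, rfl, rfl⟩

theorem quatK_parts : quatK.re = 0 ∧ quatK.imI = 0 ∧ quatK.imJ = 0 ∧ quatK.imK = 1 :=
  ⟨rfl, rfl, rfl, rfl⟩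

/-- The complex `2 × 2` matrix of a quaternion, `a + b i + c j + d k ↦ (z, -w̄; w, z̄)` with
`z = a + b i`, `w = c - d i`. It is the matrix of left multiplication by the quaternion on
`ℍ = ℂ²`, where `ℂ` acts on `ℍ` from the right and `ψ ∈ ℍ` is identified with the first column of
its matrix. -/
def quatMatrix (q : ℍ[ℝ]) : Matrix (Fin 2) (Fin 2) ℂ :=
  !![⟨q.re, q.imI⟩, -⟨q.imJ, q.imK⟩;
     ⟨q.imJ, -q.imK⟩, ⟨q.re, -q.imI⟩]

/-- The identification `ℍ = ℂ²`: a spinor as a column vector. -/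
def quatColumn (q : ℍ[ℝ]) : Fin 2 → ℂ := fun r => quatMatrix q r 0

/-- The oriented orthonormal basis of `V = ℝ⁴` as quaternions. Its matrices are those of the
coordinates `(a, b, c, d)` in `(a + b i, -c + d i; c + d i, a - b i)`. -/
def quatBasis : Fin 4 → ℍ[ℝ] := ![1, quatI, quatJ, -quatK]

/-- The matrix in `SO(4)`, with respect to `quatBasis`, of the action
`v ↦ p₋ v p₊⁻¹` of `Spin(4)` on `V`. -/
def rotation (t : Spin4) (α β : Fin 4) : ℝ :=
  inner ℝ (quatBasis α) ((t.1 : ℍ[ℝ]) * quatBasis β * star (t.2 : ℍ[ℝ]))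

/-- The two chiralities of spinors. -/
inductive Chirality
  | pos
  | neg

/-- The component of `Spin(4)` acting on `W^±` (by left multiplication). -/
def chiralPart : Chirality → Spin4 → ℍ[ℝ]
  | .pos, t => (t.2 : ℍ[ℝ])
  | .neg, t => (t.1 : ℍ[ℝ])

/-- The action of `Spin(4)` on `V ⊗ W^±`. An element `∑ e_α ⊗ ψ_α` is given by `(ψ_α)_α`, and
`(p₋, p₊)` maps it to `∑ p₋ e_α p₊⁻¹ ⊗ p_± ψ_α`. -/
def spinAct (c : Chirality) (t : Spin4) (ψ : Fin 4 → ℍ[ℝ]) : Fin 4 → ℍ[ℝ] :=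
  fun α => ∑ β, rotation t α β • (chiralPart c t * ψ β)

/-- Clifford multiplication by the basis vector `e_α`, `ρ(v) = (0, -v̄ᵗ; v, 0)`, as left
multiplication by a quaternion: it is `v : W⁺ → W⁻` and `-v̄ : W⁻ → W⁺`. -/
def clifford : Chirality → Fin 4 → ℍ[ℝ]
  | .pos, α => quatBasis α
  | .neg, α => -star (quatBasis α)

/-- Clifford contraction `ρ : V ⊗ W^± → W^∓`, `∑ e_α ⊗ ψ_α ↦ ∑ ρ(e_α) ψ_α`. -/
def contraction (c : Chirality) (ψ : Fin 4 → ℍ[ℝ]) : ℍ[ℝ] :=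
  ∑ α, clifford c α * ψ α

/-- The orthogonal projection `π⁻ : V ⊗ W⁻ → ker ρ`,
`π⁻(φ) = φ + 1/4 ∑ e_α ⊗ ρ(e_α) ρ(φ)`. -/
def projNeg (φ : Fin 4 → ℍ[ℝ]) : Fin 4 → ℍ[ℝ] :=
  fun α => φ α + (1 / 4 : ℝ) • (clifford .pos α * contraction .neg φ)

/-- `a · ψ` in `V ⊗ W⁻`, for the complex covector with components `a_α` and
`ψ = ∑ e_δ ⊗ ψ_δ ∈ V ⊗ W⁺`: it is `∑ e_δ ⊗ ρ(a) ψ_δ`, complex scalars acting on the spinors from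
the right. -/
def covectorMul (a : Fin 4 → ℂ) (ψ : Fin 4 → ℍ[ℝ]) : Fin 4 → ℍ[ℝ] :=
  fun δ => ∑ α, clifford .pos α * ψ δ * (a α : ℍ[ℝ])

/-- `ρ(e_α) ρ(e_β)` on `W⁺`, as left multiplication by a quaternion. -/
def cliffordPair (α β : Fin 4) : ℍ[ℝ] := clifford .neg α * clifford .pos β

/-- The quadratic map `μ(ψ) = ψψ* - 1/2 tr(ψψ*) 1`, an endomorphism of `W⁺ = ℂ²`, for
`ψ ∈ V ⊗ W⁺ = Hom(V, W⁺)`. -/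
def mu (ψ : Fin 4 → ℍ[ℝ]) : Matrix (Fin 2) (Fin 2) ℂ :=
  let T := ∑ α, Matrix.vecMulVec (quatColumn (ψ α)) (star (quatColumn (ψ α)))
  T - ((1 / 2 : ℂ) * T.trace) • (1 : Matrix (Fin 2) (Fin 2) ℂ)

/-- The Levi-Civita symbol on four indices, `∏_{r < s} sign (x_s - x_r)`. -/
def epsilon (α β γ δ : Fin 4) : ℤ :=
  Int.sign ((β : ℤ) - α) * Int.sign ((γ : ℤ) - α) * Int.sign ((δ : ℤ) - α) *
    Int.sign ((γ : ℤ) - β) * Int.sign ((δ : ℤ) - β) * Int.sign ((δ : ℤ) - γ)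

/-- The Hodge star on two-forms, in components with respect to an oriented orthonormal basis. -/
def hodge (η : Fin 4 → Fin 4 → ℂ) : Fin 4 → Fin 4 → ℂ :=
  fun α β => (1 / 2 : ℂ) * ∑ γ, ∑ δ, (epsilon α β γ δ : ℂ) * η γ δ

/-- The self-dual part of a two-form, in components. -/
def selfDualPart (η : Fin 4 → Fin 4 → ℂ) : Fin 4 → Fin 4 → ℂ :=
  fun α β => (1 / 2 : ℂ) * (η α β + hodge η α β)

/-- Clifford multiplication by the two-form `∑_{α<β} η_{αβ} e_α ∧ e_β` on `W⁺ = ℂ²`: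
`ρ(η) = ∑_{α<β} η_{αβ} ρ(e_α) ρ(e_β)`. -/
def rhoTwo (η : Fin 4 → Fin 4 → ℂ) : Matrix (Fin 2) (Fin 2) ℂ :=
  ∑ α, ∑ β, if α < β then η α β • quatMatrix (cliffordPair α β) else 0

/-- The inverse of the isomorphism `ρ : iΛ⁺ → i𝔰𝔲(W⁺)` (see `rhoTwo_rhoInv` and
`rhoInv_rhoTwo`). -/
def rhoInv (T : Matrix (Fin 2) (Fin 2) ℂ) : Fin 4 → Fin 4 → ℂ :=
  fun α β => if α = β then 0 else -(1 / 4 : ℂ) * (T * quatMatrix (cliffordPair α β)).trace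

/-- Components of an element of `iΛ⁺`. -/
def IsImSelfDual (η : Fin 4 → Fin 4 → ℂ) : Prop :=
  (∀ α β, (η α β).re = 0) ∧ (∀ α β, η β α = -η α β) ∧ hodge η = η


theorem quatMatrix_mul (p q : ℍ[ℝ]) : quatMatrix (p * q) = quatMatrix p * quatMatrix q := by
  ext r s
  fin_cases r <;> fin_cases s <;> apply Complex.ext <;>
    simp [quatMatrix, Matrix.mul_apply, Fin.sum_univ_two] <;> ring

/-- Multiplication by complex scalars on `W^± = ℂ²` is right multiplication of quaternions. -/
theorem quatColumn_mul_complex (ψ : ℍ[ℝ]) (z : ℂ) :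
    quatColumn (ψ * (z : ℍ[ℝ])) = z • quatColumn ψ := by
  ext r
  fin_cases r <;> apply Complex.ext <;>
    simp [quatColumn, quatMatrix] <;> ring

theorem quatColumn_mul (q ψ : ℍ[ℝ]) :
    quatColumn (q * ψ) = quatMatrix q *ᵥ quatColumn ψ := by
  ext r
  simp only [quatColumn, quatMatrix_mul, Matrix.mul_apply, Matrix.mulVec, dotProduct]

theorem hodge_eq (η : Fin 4 → Fin 4 → ℂ) (hη : ∀ α β, η β α = -η α β) :
    hodge η = !![0, η 2 3, -η 1 3, η 1 2; -η 2 3, 0, η 0 3, -η 0 2;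
      η 1 3, -η 0 3, 0, η 0 1; -η 1 2, η 0 2, -η 0 1, 0] := by
  have h10 := hη 0 1
  have h20 := hη 0 2
  have h30 := hη 0 3
  have h21 := hη 1 2
  have h31 := hη 1 3
  have h32 := hη 2 3
  have e2 : Int.sign 2 = 1 := rfl
  have e3 : Int.sign 3 = 1 := rfl
  ext α β
  fin_cases α <;> fin_cases β <;>
    simp [hodge, epsilon, Fin.sum_univ_four, h10, h20, h30, h21, h31, h32, e2, e3] <;> ring

theorem cliffordPair_eq : cliffordPair =
    ![![-1, -quatI, -quatJ, quatK], ![quatI, -1, quatK, quatJ],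
      ![quatJ, -quatK, -1, -quatI], ![-quatK, -quatJ, quatI, -1]] := by
  funext α β
  fin_cases α <;> fin_cases β <;> apply Quaternion.ext <;>
    simp [cliffordPair, clifford, quatBasis, quatI_parts, quatJ_parts, quatK_parts]

theorem rhoTwo_eq (η : Fin 4 → Fin 4 → ℂ) :
    rhoTwo η = !![-Complex.I * (η 0 1 + η 2 3), (η 0 2 - η 1 3) - Complex.I * (η 0 3 + η 1 2);
      -(η 0 2 - η 1 3) - Complex.I * (η 0 3 + η 1 2), Complex.I * (η 0 1 + η 2 3)] := by
  ext r s
  fin_cases r <;> fin_cases s <;> apply Complex.ext <;>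
    simp [rhoTwo, cliffordPair_eq, quatMatrix, quatI_parts, quatJ_parts, quatK_parts, Fin.sum_univ_succ] <;> ring

theorem rhoInv_eq (T : Matrix (Fin 2) (Fin 2) ℂ) (h : T 1 1 = -T 0 0) :
    rhoInv T = !![0, Complex.I / 2 * T 0 0, (T 0 1 - T 1 0) / 4, Complex.I / 4 * (T 0 1 + T 1 0);
      -(Complex.I / 2 * T 0 0), 0, Complex.I / 4 * (T 0 1 + T 1 0), -(T 0 1 - T 1 0) / 4;
      -(T 0 1 - T 1 0) / 4, -(Complex.I / 4 * (T 0 1 + T 1 0)), 0, Complex.I / 2 * T 0 0;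
      -(Complex.I / 4 * (T 0 1 + T 1 0)), (T 0 1 - T 1 0) / 4, -(Complex.I / 2 * T 0 0), 0] := by
  ext α β
  fin_cases α <;> fin_cases β <;> apply Complex.ext <;>
    simp [rhoInv, cliffordPair_eq, quatMatrix, quatI_parts, quatJ_parts, quatK_parts,
      Matrix.trace_fin_two, Matrix.mul_apply, h] <;> ring

/-- `rhoInv` takes values in `iΛ⁺` on `i𝔰𝔲(W⁺)`, the traceless Hermitian endomorphisms. -/
theorem isImSelfDual_rhoInv (T : Matrix (Fin 2) (Fin 2) ℂ) (hT : T.IsHermitian)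
    (h0 : T.trace = 0) : IsImSelfDual (rhoInv T) := by
  have h : T 1 1 = -T 0 0 := by
    rw [Matrix.trace_fin_two] at h0
    linear_combination h0
  have ha : (T 0 0).im = 0 := by
    have := congrArg Complex.im (hT.apply 0 0)
    simp at this
    linarith
  have hr : (T 1 0).re = (T 0 1).re := by simpa using congrArg Complex.re (hT.apply 1 0).symm
  have hi : (T 1 0).im = -(T 0 1).im := by simpa using congrArg Complex.im (hT.apply 1 0).symm
  have anti : ∀ α β, rhoInv T β α = -rhoInv T α β := by
    rw [rhoInv_eq T h]
    intro α β
    fin_cases α <;> fin_cases β <;> simp <;> ring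
  refine ⟨?_, anti, ?_⟩
  · rw [rhoInv_eq T h]
    intro α β
    fin_cases α <;> fin_cases β <;> simp [ha, hr, hi]
  · rw [hodge_eq _ anti, rhoInv_eq T h]
    ext α β
    fin_cases α <;> fin_cases β <;> simp <;> ring

theorem rhoTwo_rhoInv (T : Matrix (Fin 2) (Fin 2) ℂ) (h0 : T.trace = 0) :
    rhoTwo (rhoInv T) = T := by
  have h : T 1 1 = -T 0 0 := by
    rw [Matrix.trace_fin_two] at h0
    linear_combination h0
  have hI := Complex.I_mul_I
  rw [rhoTwo_eq, rhoInv_eq T h]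
  ext r s
  fin_cases r <;> fin_cases s <;> simp [h]
  · linear_combination (-T 0 0) * hI
  · linear_combination (-(T 0 1 + T 1 0) / 2) * hI
  · linear_combination (-(T 0 1 + T 1 0) / 2) * hI
  · linear_combination (T 0 0) * hI

theorem rhoInv_rhoTwo (η : Fin 4 → Fin 4 → ℂ) (hη : IsImSelfDual η) :
    rhoInv (rhoTwo η) = η := by
  obtain ⟨-, h1, h2⟩ := hη
  have hI := Complex.I_mul_I
  have e1 : η 2 3 = η 0 1 := by
    have := congrFun (congrFun ((hodge_eq η h1).symm.trans h2) 0) 1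
    simpa using this
  have e2 : η 1 3 = -η 0 2 := by
    have := congrFun (congrFun ((hodge_eq η h1).symm.trans h2) 0) 2
    simpa [neg_eq_iff_eq_neg] using this
  have e3 : η 1 2 = η 0 3 := by
    have := congrFun (congrFun ((hodge_eq η h1).symm.trans h2) 0) 3
    simpa using this
  have d : ∀ α, η α α = 0 := fun α => self_eq_neg.mp (h1 α α)
  rw [rhoTwo_eq, rhoInv_eq _ (by simp)]
  ext α β
  fin_cases α <;> fin_cases β <;>
    simp [d, e1, e2, e3, h1 0 1, h1 0 2, h1 0 3, h1 1 2, h1 1 3, h1 2 3] <;>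
    first | ring1 | linear_combination (-η 0 1) * hI | linear_combination (η 0 1) * hI |
      linear_combination (-η 0 3) * hI

theorem mu_isHermitian (ψ : Fin 4 → ℍ[ℝ]) : (mu ψ).IsHermitian := by
  ext r s
  fin_cases r <;> fin_cases s <;> apply Complex.ext <;>
    simp [mu, Matrix.vecMulVec_apply, quatColumn, quatMatrix, Fin.sum_univ_four] <;> ring

theorem mu_trace (ψ : Fin 4 → ℍ[ℝ]) : (mu ψ).trace = 0 := by
  simp [mu, Matrix.trace_sub, Matrix.trace_smul]
  ring


/-! ### The group `Pin(2)` -/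

/-- `Pin(2) = S¹ ⊔ j S¹`, as a subgroup of `SU(2)`, the unit quaternions. -/
def pin2 : Subgroup (unitary ℍ[ℝ]) where
  carrier := {q | ∃ z : ℂ, (q : ℍ[ℝ]) = z ∨ (q : ℍ[ℝ]) = quatJ * z}
  one_mem' := ⟨1, Or.inl (by simp)⟩
  mul_mem' := by
    rintro p q ⟨z, hz⟩ ⟨w, hw⟩
    simp only [Set.mem_ofPred_eq, Submonoid.coe_mul]
    rcases hz with hz | hz <;> rcases hw with hw | hw <;> rw [hz, hw]
    · exact ⟨z * w, Or.inl (by simp)⟩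
    · exact ⟨star z * w, Or.inr (by ext <;> simp [quatJ_parts]; ring)⟩
    · exact ⟨z * w, Or.inr (by simp [mul_assoc])⟩
    · exact ⟨-(star z * w), Or.inl (by ext <;> simp [quatJ_parts] <;> ring)⟩
  inv_mem' := by
    rintro p ⟨z, hz⟩
    have hp : ((p⁻¹ : unitary ℍ[ℝ]) : ℍ[ℝ]) = star (p : ℍ[ℝ]) := rfl
    simp only [Set.mem_ofPred_eq, hp]
    rcases hz with hz | hz <;> rw [hz]
    · exact ⟨star z, Or.inl (by ext <;> simp)⟩
    · exact ⟨-z, Or.inr (by ext <;> simp [quatJ_parts])⟩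

/-- The character of `Pin(2)` on `ℝ̃`: it is `1` on `S¹` and `-1` on `j S¹`
(see `pinSign_complex` and `pinSign_j_mul_complex`). -/
def pinSign : pin2 →* ℝ where
  toFun p := (p : ℍ[ℝ]).re ^ 2 + (p : ℍ[ℝ]).imI ^ 2 - (p : ℍ[ℝ]).imJ ^ 2 - (p : ℍ[ℝ]).imK ^ 2
  map_one' := by simp
  map_mul' := by
    rintro ⟨p, z, hz⟩ ⟨q, w, hw⟩
    simp only [Subgroup.coe_mul, Submonoid.coe_mul]
    rcases hz with hz | hz <;> rcases hw with hw | hw <;> rw [hz, hw] <;>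
      simp [quatJ_parts] <;> ring

theorem norm_unitary (p : unitary ℍ[ℝ]) : (p : ℍ[ℝ]).re ^ 2 + (p : ℍ[ℝ]).imI ^ 2 +
    (p : ℍ[ℝ]).imJ ^ 2 + (p : ℍ[ℝ]).imK ^ 2 = 1 := by
  have h := congrArg QuaternionAlgebra.re (Unitary.coe_mul_star_self p)
  rw [Quaternion.re_mul] at h
  simp only [Unitary.coe_star, Quaternion.re_star, Quaternion.imI_star, Quaternion.imJ_star,
    Quaternion.imK_star, Quaternion.re_one] at h
  linarith

theorem pinSign_complex (p : pin2) (z : ℂ) (hp : (p : ℍ[ℝ]) = z) : pinSign p = 1 := by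
  have h := norm_unitary p.1
  rw [hp] at h
  simp at h
  simp [pinSign, hp, h]

theorem pinSign_j_mul_complex (p : pin2) (z : ℂ) (hp : (p : ℍ[ℝ]) = quatJ * z) :
    pinSign p = -1 := by
  have h := norm_unitary p.1
  rw [hp] at h
  simp [quatJ_parts] at h
  simp [pinSign, hp, quatJ_parts]
  linarith

/-- The action of `Pin(2)` on `V ⊗ W^±` by quaternionic right multiplication on the spinors:
`∑ e_α ⊗ ψ_α ↦ ∑ e_α ⊗ ψ_α p⁻¹`. -/
def pinAct (p : pin2) (ψ : Fin 4 → ℍ[ℝ]) : Fin 4 → ℍ[ℝ] :=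
  fun α => ψ α * ((p⁻¹ : pin2) : ℍ[ℝ])

theorem spinAct_pinAct (c : Chirality) (t : Spin4) (p : pin2) (ψ : Fin 4 → ℍ[ℝ]) :
    pinAct p (spinAct c t ψ) = spinAct c t (pinAct p ψ) := by
  funext α
  simp only [pinAct, spinAct, Finset.sum_mul, smul_mul_assoc, mul_assoc]

theorem contraction_pinAct (c : Chirality) (p : pin2) (ψ : Fin 4 → ℍ[ℝ]) :
    contraction c (pinAct p ψ) = contraction c ψ * ((p⁻¹ : pin2) : ℍ[ℝ]) := by
  simp only [pinAct, contraction, Finset.sum_mul, mul_assoc]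

theorem IsImSelfDual.smul {η : Fin 4 → Fin 4 → ℂ} (hη : IsImSelfDual η) (r : ℝ) :
    IsImSelfDual (fun α β => r • η α β) := by
  obtain ⟨h1, h2, h3⟩ := hη
  refine ⟨fun α β => by simp [h1 α β], fun α β => by simp [h2 α β], ?_⟩
  funext α β
  conv_rhs => rw [← h3]
  simp only [hodge, Finset.mul_sum, Finset.smul_sum, Complex.real_smul]
  exact Finset.sum_congr rfl fun γ _ => Finset.sum_congr rfl fun δ _ => by ring

/-! ### Spin structures on a Riemannian four-manifold -/

universe u v

section Manifold

variable {X : Type u} [TopologicalSpace X] [ChartedSpace (EuclideanSpace ℝ (Fin 4)) X]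
  [IsManifold (𝓡 4) ∞ X]

/-- A smooth Riemannian metric on the four-manifold `X`. -/
abbrev RiemMetric (X : Type u) [TopologicalSpace X] [ChartedSpace (EuclideanSpace ℝ (Fin 4)) X]
    [IsManifold (𝓡 4) ∞ X] : Type u :=
  Bundle.ContMDiffRiemannianMetric (𝓡 4) ∞ (EuclideanSpace ℝ (Fin 4))
    (fun x : X => TangentSpace (𝓡 4) x)

/-- A spin structure on the Riemannian four-manifold `(X, g)` (together with the orientation that
it induces), given by an atlas of local sections of the principal `Spin(4)`-bundle `P`. The `i`-th
local section lies over the local orthonormal frame `frame i` on `U i`; two of them differ by the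
`Spin(4)`-valued cocycle `trans`, which lifts the transition functions of the frames along
`Spin(4) → SO(4)`. -/
structure SpinStructure (g : RiemMetric X) where
  /-- The indices of the local sections. -/
  ι : Type v
  /-- The domain of a local section. -/
  U : ι → Set X
  isOpen_U : ∀ i, IsOpen (U i)
  cover : ∀ x, ∃ i, x ∈ U i
  /-- The local orthonormal frame `e_0, …, e_3` below a local section. -/
  frame : ι → Fin 4 → (x : X) → TangentSpace (𝓡 4) x
  smooth_frame : ∀ i α, ContMDiffOn (𝓡 4) (𝓡 4).tangent ∞
    (fun x => (⟨x, frame i α x⟩ : TangentBundle (𝓡 4) X)) (U i)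
  orthonormal : ∀ i, ∀ x ∈ U i, ∀ α β,
    g.inner x (frame i α x) (frame i β x) = if α = β then 1 else 0
  /-- The transition functions: `σ_j = σ_i · trans i j` for the local sections of `P`. -/
  trans : ι → ι → X → Spin4
  smooth_trans : ∀ i j, ContMDiffOn (𝓡 4) 𝓘(ℝ, ℍ[ℝ] × ℍ[ℝ]) ∞
    (fun x => (((trans i j x).1 : ℍ[ℝ]), ((trans i j x).2 : ℍ[ℝ]))) (U i ∩ U j)
  cocycle : ∀ i j k, ∀ x ∈ U i ∩ U j ∩ U k, trans i j x * trans j k x = trans i k x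
  frame_trans : ∀ i j, ∀ x ∈ U i ∩ U j, ∀ β,
    frame j β x = ∑ α, rotation (trans i j x) α β • frame i α x

namespace SpinStructure

variable {g : RiemMetric X} (s : SpinStructure.{u, v} g)

/-! ### Differential operators in a local spin frame -/

/-- The derivative of a function in the direction of the frame vector `e_α`. -/
def frameDeriv {F : Type*} [NormedAddCommGroup F] [NormedSpace ℝ F] (i : s.ι) (α : Fin 4)
    (f : X → F) (x : X) : F :=
  mfderiv (𝓡 4) 𝓘(ℝ, F) f x (s.frame i α x)

/-- The vector field `[e_α, e_β]`. -/
def bracket (i : s.ι) (α β : Fin 4) (x : X) : TangentSpace (𝓡 4) x :=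
  VectorField.mlieBracket (𝓡 4) (s.frame i α) (s.frame i β) x

/-- The coefficient `g(∇_{e_α} e_β, e_γ)` of the Levi-Civita connection, by the Koszul formula in
an orthonormal frame. -/
def leviCivita (i : s.ι) (α β γ : Fin 4) (x : X) : ℝ :=
  (1 / 2) * (g.inner x (s.bracket i α β x) (s.frame i γ x)
    - g.inner x (s.bracket i β γ x) (s.frame i α x)
    + g.inner x (s.bracket i γ α x) (s.frame i β x))

/-- The covariant derivative `∇_{e_α} ψ` of a section `ψ = ∑ e_δ ⊗ ψ_δ` of `TX ⊗ 𝔰⁺_{1/2}`: the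
tensor product of the Levi-Civita connection and the spin connection, whose form on `𝔰⁺_{1/2}` is
`1/4 ∑_{β,γ} g(∇e_β, e_γ) ρ(e_β) ρ(e_γ)`. -/
def covDeriv (i : s.ι) (α : Fin 4) (ψ : X → Fin 4 → ℍ[ℝ]) (x : X) : Fin 4 → ℍ[ℝ] :=
  fun δ => s.frameDeriv i α (fun y => ψ y δ) x
    + ∑ β, s.leviCivita i α β δ x • ψ x β
    + (1 / 4 : ℝ) • ∑ β, ∑ γ, s.leviCivita i α β γ x • (cliffordPair β γ * ψ x δ)

/-- The Dirac operator `𝒟⁺ : Γ(𝔰⁺_{1/2} ⊗ TX) → Γ(𝔰⁻_{1/2} ⊗ TX)`, `∑_α ρ(e_α) ∇_{e_α}`. -/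
def dirac (i : s.ι) (ψ : X → Fin 4 → ℍ[ℝ]) (x : X) : Fin 4 → ℍ[ℝ] :=
  fun δ => ∑ α, clifford .pos α * s.covDeriv i α ψ x δ

/-- The Rarita-Schwinger operator `Q⁺ = π⁻ ∘ 𝒟⁺`. -/
def raritaSchwinger (i : s.ι) (ψ : X → Fin 4 → ℍ[ℝ]) (x : X) : Fin 4 → ℍ[ℝ] :=
  projNeg (s.dirac i ψ x)

/-- The components `a(e_α)` of a complex-valued one-form. -/
def components (i : s.ι) (a : (x : X) → TangentSpace (𝓡 4) x →L[ℝ] ℂ) (x : X) : Fin 4 → ℂ :=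
  fun α => a x (s.frame i α x)

/-- The components `η(e_α, e_β)` of a complex-valued two-form. -/
def components₂ (i : s.ι)
    (η : (x : X) → TangentSpace (𝓡 4) x →L[ℝ] TangentSpace (𝓡 4) x →L[ℝ] ℂ) (x : X) :
    Fin 4 → Fin 4 → ℂ :=
  fun α β => η x (s.frame i α x) (s.frame i β x)

/-- The codifferential `d*a = -∑_α (∇_{e_α} a)(e_α)`. -/
def codiff (i : s.ι) (a : (x : X) → TangentSpace (𝓡 4) x →L[ℝ] ℂ) (x : X) : ℂ :=
  -∑ α, (s.frameDeriv i α (fun y => s.components i a y α) x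
    - ∑ γ, (s.leviCivita i α α γ x : ℂ) * s.components i a x γ)

/-- The components of the exterior derivative,
`da(e_α, e_β) = e_α(a(e_β)) - e_β(a(e_α)) - a([e_α, e_β])`. -/
def extDerivComponents (i : s.ι) (a : (x : X) → TangentSpace (𝓡 4) x →L[ℝ] ℂ) (x : X) :
    Fin 4 → Fin 4 → ℂ :=
  fun α β => s.frameDeriv i α (fun y => s.components i a y β) x
    - s.frameDeriv i β (fun y => s.components i a y α) x - a x (s.bracket i α β x)

/-! ### The configuration space and the range space -/

/-- Smooth sections of `𝔰^±_{3/2} = ker ρ ⊂ TX ⊗ 𝔰^±_{1/2}`. A section of the associated bundle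
`TX ⊗ 𝔰^±_{1/2} = P ×_{Spin(4)} (V ⊗ W^±)` is a compatible family of local functions
`ψ_i : U i → V ⊗ W^±`, here extended by zero. -/
@[ext]
structure ThreeHalfSpinor (c : Chirality) where
  /-- The local representatives. -/
  toFun : s.ι → X → Fin 4 → ℍ[ℝ]
  eq_zero : ∀ i, ∀ x ∉ s.U i, toFun i x = 0
  compat : ∀ i j, ∀ x ∈ s.U i ∩ s.U j, toFun i x = spinAct c (s.trans i j x) (toFun j x)
  smooth : ∀ i, ContMDiffOn (𝓡 4) 𝓘(ℝ, Fin 4 → ℍ[ℝ]) ∞ (toFun i) (s.U i)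
  contraction_eq_zero : ∀ i, ∀ x ∈ s.U i, contraction c (toFun i x) = 0

/-- `iΩ⁰(X)`. -/
@[ext]
structure ImFunction where
  /-- The underlying function. -/
  toFun : X → ℂ
  imaginary : ∀ x, (toFun x).re = 0
  smooth : ContMDiff (𝓡 4) 𝓘(ℝ, ℂ) ∞ toFun

/-- `iΩ¹(X)`. -/
@[ext]
structure ImOneForm where
  /-- The underlying one-form. -/
  toFun : (x : X) → TangentSpace (𝓡 4) x →L[ℝ] ℂ
  imaginary : ∀ x v, (toFun x v).re = 0
  smooth : ∀ i α, ContMDiffOn (𝓡 4) 𝓘(ℝ, ℂ) ∞ (fun x => s.components i toFun x α) (s.U i)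

/-- `iΩ⁺(X)`, the imaginary-valued self-dual two-forms. -/
@[ext]
structure ImSelfDualForm where
  /-- The underlying bilinear form at each point. -/
  toFun : (x : X) → TangentSpace (𝓡 4) x →L[ℝ] TangentSpace (𝓡 4) x →L[ℝ] ℂ
  imSelfDual : ∀ i, ∀ x ∈ s.U i, IsImSelfDual (s.components₂ i toFun x)
  smooth : ∀ i α β,
    ContMDiffOn (𝓡 4) 𝓘(ℝ, ℂ) ∞ (fun x => s.components₂ i toFun x α β) (s.U i)

/-- The configuration space `𝒞 = Γ(𝔰⁺_{3/2}) ⊕ iΩ¹(X)`. -/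
abbrev Config : Type (max u v) := s.ThreeHalfSpinor .pos × s.ImOneForm

/-- The range space `ℛ = Γ(𝔰⁻_{3/2}) ⊕ iΩ⁰(X) ⊕ iΩ⁺(X)`. -/
abbrev Range : Type (max u v) :=
  s.ThreeHalfSpinor .neg × ImFunction (X := X) × s.ImSelfDualForm

/-! ### The action of `Pin(2)` -/

variable {s}

/-- `Pin(2)` acts on `3/2`-spinors by quaternionic right multiplication, `ψ ↦ ψ p⁻¹`. -/
instance (c : Chirality) : MulAction pin2 (s.ThreeHalfSpinor c) where
  smul p ψ :=
    { toFun := fun i x => pinAct p (ψ.toFun i x)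
      eq_zero := by
        intro i x hx
        ext1 α
        simp [pinAct, ψ.eq_zero i x hx]
      compat := by
        intro i j x hx
        rw [ψ.compat i j x hx, spinAct_pinAct]
      smooth := by
        intro i
        rw [contMDiffOn_pi_space]
        intro α
        have h := contMDiffOn_pi_space.1 (ψ.smooth i) α
        exact (((ContinuousLinearMap.mul ℝ ℍ[ℝ]).flip
          ((p⁻¹ : pin2) : ℍ[ℝ])).contMDiff (n := ∞)).comp_contMDiffOn h
      contraction_eq_zero := by
        intro i x hx
        rw [contraction_pinAct, ψ.contraction_eq_zero i x hx, zero_mul] }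
  one_smul ψ := by
    apply ThreeHalfSpinor.ext
    funext i x α
    change ψ.toFun i x α * (((1 : pin2)⁻¹ : pin2) : ℍ[ℝ]) = _
    simp
  mul_smul p q ψ := by
    apply ThreeHalfSpinor.ext
    funext i x α
    change ψ.toFun i x α * (((p * q)⁻¹ : pin2) : ℍ[ℝ]) =
      ψ.toFun i x α * ((q⁻¹ : pin2) : ℍ[ℝ]) * ((p⁻¹ : pin2) : ℍ[ℝ])
    rw [mul_inv_rev, mul_assoc]
    rfl

/-- `Pin(2)` acts on `iΩ⁰(X)` through the character `pinSign`. -/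
instance : MulAction pin2 (ImFunction (X := X)) where
  smul p f :=
    { toFun := fun x => pinSign p • f.toFun x
      imaginary := by
        intro x
        simp [f.imaginary x]
      smooth := by
        have h : ContMDiff (𝓡 4) 𝓘(ℝ, ℝ) ∞ (fun _ : X => pinSign p) := contMDiff_const
        exact h.smul f.smooth }
  one_smul f := by
    apply ImFunction.ext
    funext x
    change pinSign 1 • f.toFun x = _
    simp
  mul_smul p q f := by
    apply ImFunction.ext
    funext x
    change pinSign (p * q) • f.toFun x = pinSign p • pinSign q • f.toFun x
    rw [map_mul, mul_smul]

/-- `Pin(2)` acts on `iΩ¹(X)` through the character `pinSign`. -/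
instance : MulAction pin2 s.ImOneForm where
  smul p a :=
    { toFun := fun x => pinSign p • a.toFun x
      imaginary := by
        intro x v
        simp [a.imaginary x v]
      smooth := by
        intro i α
        have h : ContMDiffOn (𝓡 4) 𝓘(ℝ, ℝ) ∞ (fun _ : X => pinSign p) (s.U i) :=
          contMDiffOn_const
        exact h.smul (a.smooth i α) }
  one_smul a := by
    apply ImOneForm.ext
    funext x
    change pinSign 1 • a.toFun x = _
    simp
  mul_smul p q a := by
    apply ImOneForm.ext
    funext x
    change pinSign (p * q) • a.toFun x = pinSign p • pinSign q • a.toFun x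
    rw [map_mul, mul_smul]

/-- `Pin(2)` acts on `iΩ⁺(X)` through the character `pinSign`. -/
instance : MulAction pin2 s.ImSelfDualForm where
  smul p η :=
    { toFun := fun x => pinSign p • η.toFun x
      imSelfDual := by
        intro i x hx
        exact (η.imSelfDual i x hx).smul (pinSign p)
      smooth := by
        intro i α β
        have h : ContMDiffOn (𝓡 4) 𝓘(ℝ, ℝ) ∞ (fun _ : X => pinSign p) (s.U i) :=
          contMDiffOn_const
        exact h.smul (η.smooth i α β) }
  one_smul η := by
    apply ImSelfDualForm.ext
    funext x
    change pinSign 1 • η.toFun x = _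
    simp
  mul_smul p q η := by
    apply ImSelfDualForm.ext
    funext x
    change pinSign (p * q) • η.toFun x = pinSign p • pinSign q • η.toFun x
    rw [map_mul, mul_smul]

variable (s)

/-- `F : 𝒞 → ℛ` is the functional
`F(ψ, a) = (Q⁺ψ + π⁻(a · ψ), d*a, d⁺a - ρ⁻¹(μ(ψ)))`: the three components are given by these
expressions at every point and in every local spin frame. -/
def IsRSSWFunctional (F : s.Config → s.Range) : Prop :=
  ∀ (ψ : s.ThreeHalfSpinor .pos) (a : s.ImOneForm) (i : s.ι), ∀ x ∈ s.U i,
    (F (ψ, a)).1.toFun i x = s.raritaSchwinger i (ψ.toFun i) x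
        + projNeg (covectorMul (s.components i a.toFun x) (ψ.toFun i x)) ∧
    (F (ψ, a)).2.1.toFun x = s.codiff i a.toFun x ∧
    s.components₂ i (F (ψ, a)).2.2.toFun x =
      selfDualPart (s.extDerivComponents i a.toFun x) - rhoInv (mu (ψ.toFun i x))

end SpinStructure

end Manifold

end RSSW

end

noncomputable section

namespace RSSW

/-! ### Algebra of the rotations covered by `Spin(4)` -/

/-! The formula is local, so well-definedness is a comparison of two spin frames. On an overlap they
differ by a function `t = (p₋, p₊)` with values in `Spin(4)`, covering a rotation `R`. The local
expressions define an element of the range space exactly when the first transforms by the action on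
`V ⊗ W⁻` and lies in the kernel of contraction, the second is frame independent and imaginary, the
third transforms as an imaginary self-dual two-form, and all are smooth.

The zeroth-order terms are pure algebra. Clifford multiplication is equivariant
(`rotation_smul_clifford_pos`, `rotation_smul_clifford_neg'`), hence so are `π⁻` and `a · ψ`. The
matrix `μ(ψ)` is conjugated by `p₊` (`mu_spinAct`), and `ρ⁻¹` turns this conjugation into the
rotation of two-forms (`rhoInv_conj`).

The first-order terms produce derivatives of `R`, `p₋` and `p₊`. The Koszul formula gives the affine
transformation law of the Levi-Civita coefficients (`leviCivita_trans`). Its inhomogeneous part has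
spin connection value `p̄₊ dp₊` (`spinConnection_rotationDeriv`), precisely the term needed to
absorb the derivative of `p₊` acting on spinors. This gives the covariance of `∇`, the Dirac
operator and `d*` (`covDeriv_trans`, `dirac_trans`, `codiff_trans`). For `da` the derivatives of `R`
cancel against those in the Lie bracket (`extDerivComponents_trans`). The local expressions
therefore glue, which is existence; an element of the range space is determined by its local
expressions, which is uniqueness.

For equivariance, right multiplication by `p⁻¹` commutes with everything acting from the left. It
commutes with imaginary scalars up to the sign `pinSign p`, which cancels the sign acquired by `a`
in `a · ψ`. Finally `μ(ψ) = ½ ∑ M(ψ_α) σ M(ψ_α)*` with `σ = diag(1, -1)`, and conjugation by an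
element of `Pin(2)` multiplies `σ` by `pinSign p`, so `μ(ψ)` changes by the same sign as `d⁺a`. -/

theorem sum_inner_quatBasis_smul (q : ℍ[ℝ]) :
    ∑ α, (inner ℝ (quatBasis α) q : ℝ) • quatBasis α = q := by
  ext <;> simp [Fin.sum_univ_four, quatBasis, Quaternion.inner_def, quatI_parts, quatJ_parts,
      quatK_parts]

theorem inner_quatBasis (α β : Fin 4) :
    (inner ℝ (quatBasis α) (quatBasis β) : ℝ) = if α = β then 1 else 0 := by
  fin_cases α <;> fin_cases β <;>
    simp [-inner_self_eq_norm_sq_to_K, quatBasis, Quaternion.inner_def, quatI_parts, quatJ_parts,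
      quatK_parts]

theorem sum_inner_mul_inner_quatBasis (p q : ℍ[ℝ]) :
    ∑ α, (inner ℝ (quatBasis α) p : ℝ) * inner ℝ (quatBasis α) q = inner ℝ p q := by
  simp [Fin.sum_univ_four, quatBasis, Quaternion.inner_def, quatI_parts, quatJ_parts,
      quatK_parts]

/-- Averaging over the basis keeps only the real part. This is why `p₋` disappears from the spin
connection on `W⁺`: there `q = p̄₋ dp₋` is purely imaginary. -/
theorem sum_star_quatBasis_mul_mul (q : ℍ[ℝ]) :
    ∑ α, star (quatBasis α) * (q * quatBasis α) = ((4 * q.re : ℝ) : ℍ[ℝ]) := by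
  ext <;> simp [Fin.sum_univ_four, quatBasis, quatI_parts, quatJ_parts, quatK_parts]
  ring

theorem sum_star_quatBasis_mul : ∑ α, star (quatBasis α) * quatBasis α = ((4 : ℝ) : ℍ[ℝ]) := by
  have := sum_star_quatBasis_mul_mul 1
  simpa using this

theorem Spin4.star_fst_mul (t : Spin4) : star (t.1 : ℍ[ℝ]) * (t.1 : ℍ[ℝ]) = 1 :=
  Unitary.coe_star_mul_self t.1

theorem Spin4.fst_mul_star (t : Spin4) : (t.1 : ℍ[ℝ]) * star (t.1 : ℍ[ℝ]) = 1 :=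
  Unitary.coe_mul_star_self t.1

theorem Spin4.snd_mul_star (t : Spin4) : (t.2 : ℍ[ℝ]) * star (t.2 : ℍ[ℝ]) = 1 :=
  Unitary.coe_mul_star_self t.2

theorem Spin4.star_snd_mul (t : Spin4) : star (t.2 : ℍ[ℝ]) * (t.2 : ℍ[ℝ]) = 1 :=
  Unitary.coe_star_mul_self t.2

theorem sum_rotation_smul_quatBasis (t : Spin4) (β : Fin 4) :
    ∑ α, rotation t α β • quatBasis α =
      (t.1 : ℍ[ℝ]) * quatBasis β * star (t.2 : ℍ[ℝ]) :=
  sum_inner_quatBasis_smul _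

/-- The inner product is `Re(v w̄)`, and the real part is invariant under cyclic permutation, so the
unit factors cancel. -/
theorem inner_spin_mul (t : Spin4) (v w : ℍ[ℝ]) :
    (inner ℝ ((t.1 : ℍ[ℝ]) * v * star (t.2 : ℍ[ℝ])) ((t.1 : ℍ[ℝ]) * w * star (t.2 : ℍ[ℝ])) : ℝ) =
      inner ℝ v w := by
  have hre : ∀ a b : ℍ[ℝ], (a * b).re = (b * a).re := fun a b => by
    simp only [Quaternion.re_mul]; ring
  rw [Quaternion.inner_def, Quaternion.inner_def]
  calc _ = ((t.1 : ℍ[ℝ]) * (v * (star (t.2 : ℍ[ℝ]) * (t.2 : ℍ[ℝ])) * star w * star (t.1 : ℍ[ℝ]))).re := by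
        simp only [star_mul, star_star, mul_assoc]
    _ = (v * star w * (star (t.1 : ℍ[ℝ]) * (t.1 : ℍ[ℝ]))).re := by
        rw [t.star_snd_mul, mul_one, mul_assoc, hre]; simp only [mul_assoc]
    _ = _ := by rw [t.star_fst_mul, mul_one]

theorem sum_rotation_mul_rotation (t : Spin4) (β γ : Fin 4) :
    ∑ α, rotation t α β * rotation t α γ = if β = γ then 1 else 0 := by
  simp only [rotation]
  rw [sum_inner_mul_inner_quatBasis, inner_spin_mul, inner_quatBasis]

/-- A left inverse of a square matrix is a right inverse, so orthonormal columns give orthonormal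
rows. -/
theorem sum_rotation_mul_rotation' (t : Spin4) (α β : Fin 4) :
    ∑ γ, rotation t α γ * rotation t β γ = if α = β then 1 else 0 := by
  let M : Matrix (Fin 4) (Fin 4) ℝ := Matrix.of (rotation t)
  have h : Mᵀ * M = 1 := by
    ext β γ
    simpa [M, Matrix.mul_apply, Matrix.one_apply] using sum_rotation_mul_rotation t β γ
  have h' : (M * Mᵀ) α β = (1 : Matrix (Fin 4) (Fin 4) ℝ) α β := by rw [mul_eq_one_comm.1 h]
  simpa [M, Matrix.mul_apply, Matrix.one_apply] using h'

section Contract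

variable {E : Type*} [AddCommGroup E] [Module ℝ E]

theorem sum_rotation_smul_sum_rotation_smul (t : Spin4) (f : Fin 4 → E) (α : Fin 4) :
    ∑ γ, rotation t α γ • ∑ β, rotation t β γ • f β = f α := by
  simp only [Finset.smul_sum, smul_smul]
  rw [Finset.sum_comm]
  simp only [← Finset.sum_smul, sum_rotation_mul_rotation', ite_smul, one_smul, zero_smul,
    Finset.sum_ite_eq, Finset.mem_univ, if_true]

theorem sum_rotation_smul_sum_rotation_smul' (t : Spin4) (f : Fin 4 → E) (α : Fin 4) :
    ∑ γ, rotation t γ α • ∑ β, rotation t γ β • f β = f α := by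
  simp only [Finset.smul_sum, smul_smul]
  rw [Finset.sum_comm]
  simp only [← Finset.sum_smul, sum_rotation_mul_rotation, ite_smul, one_smul, zero_smul,
    Finset.sum_ite_eq, Finset.mem_univ, if_true]

end Contract

/-- The inverse rotation is covered by the inverse element of `Spin(4)`. -/
theorem sum_rotation_smul_quatBasis' (t : Spin4) (α : Fin 4) :
    ∑ β, rotation t α β • quatBasis β =
      star (t.1 : ℍ[ℝ]) * quatBasis α * (t.2 : ℍ[ℝ]) := by
  have h := sum_rotation_smul_sum_rotation_smul t quatBasis α
  simp only [sum_rotation_smul_quatBasis] at h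
  calc ∑ β, rotation t α β • quatBasis β
      = star (t.1 : ℍ[ℝ]) * (∑ β, rotation t α β •
          ((t.1 : ℍ[ℝ]) * quatBasis β * star (t.2 : ℍ[ℝ]))) * (t.2 : ℍ[ℝ]) := by
        rw [Finset.mul_sum, Finset.sum_mul]
        refine Finset.sum_congr rfl fun β _ => ?_
        rw [mul_smul_comm, smul_mul_assoc]
        congr 1
        calc quatBasis β = (star (t.1 : ℍ[ℝ]) * t.1) * quatBasis β * (star (t.2 : ℍ[ℝ]) * t.2) := by
              rw [t.star_fst_mul, t.star_snd_mul, one_mul, mul_one]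
          _ = _ := by simp only [mul_assoc]
    _ = _ := by rw [h]

/-- Equivariance of `ρ : V ⊗ W⁺ → W⁻`, with the rotation moved onto the index of `ρ(e_α)`; the
companion for `W⁻` is `rotation_smul_clifford_neg'`. -/
theorem rotation_smul_clifford_pos (t : Spin4) (α : Fin 4) :
    ∑ β, rotation t α β • ((t.1 : ℍ[ℝ]) * clifford .pos β) = clifford .pos α * (t.2 : ℍ[ℝ]) := by
  simp only [clifford, ← mul_smul_comm, ← Finset.mul_sum, sum_rotation_smul_quatBasis']
  rw [← mul_assoc, ← mul_assoc, t.fst_mul_star, one_mul]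

theorem rotation_smul_clifford_neg' (t : Spin4) (β : Fin 4) :
    ∑ α, rotation t α β • (clifford .neg α * (t.1 : ℍ[ℝ])) = (t.2 : ℍ[ℝ]) * clifford .neg β := by
  have h : ∑ α, rotation t α β • star (quatBasis α) =
      (t.2 : ℍ[ℝ]) * star (quatBasis β) * star (t.1 : ℍ[ℝ]) := by
    have := congrArg star (sum_rotation_smul_quatBasis t β)
    simpa [mul_assoc] using this
  simp only [clifford, neg_mul, smul_neg, Finset.sum_neg_distrib, ← smul_mul_assoc,
    ← Finset.sum_mul, h, mul_neg]
  rw [mul_assoc _ (star _), t.star_fst_mul, mul_one]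

theorem contraction_neg_spinAct (t : Spin4) (φ : Fin 4 → ℍ[ℝ]) :
    contraction .neg (spinAct .neg t φ) = (t.2 : ℍ[ℝ]) * contraction .neg φ := by
  simp only [contraction, spinAct, chiralPart, Finset.mul_sum]
  rw [Finset.sum_comm]
  refine Finset.sum_congr rfl fun β _ => ?_
  rw [← mul_assoc, ← rotation_smul_clifford_neg', Finset.sum_mul]
  exact Finset.sum_congr rfl fun α _ => by rw [mul_smul_comm, smul_mul_assoc, mul_assoc]

/-- Contraction turns the action into multiplication by `p₊`, and `e_α p₊ = ∑ R_{αβ} p₋ e_β` turns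
it back into the action on `V ⊗ W⁻`. -/
theorem projNeg_spinAct (t : Spin4) (φ : Fin 4 → ℍ[ℝ]) :
    projNeg (spinAct .neg t φ) = spinAct .neg t (projNeg φ) := by
  funext α
  rw [projNeg, contraction_neg_spinAct, ← mul_assoc, ← rotation_smul_clifford_pos]
  simp only [spinAct, chiralPart, projNeg, mul_add, smul_add, Finset.sum_add_distrib,
    Finset.sum_mul, Finset.smul_sum, smul_mul_assoc, mul_smul_comm, mul_assoc, smul_comm (1 / 4 : ℝ)]

/-- The factor `1/4` is forced by `∑ ρ(e_α) ρ(e_α) = -4`. -/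
theorem contraction_projNeg (φ : Fin 4 → ℍ[ℝ]) : contraction .neg (projNeg φ) = 0 := by
  have h : ∑ α, clifford .neg α * clifford .pos α = -((4 : ℝ) : ℍ[ℝ]) := by
    simp only [clifford, neg_mul, Finset.sum_neg_distrib, sum_star_quatBasis_mul]
  have h' : contraction .neg (projNeg φ) = contraction .neg φ + (1 / 4 : ℝ) •
      ((∑ α, clifford .neg α * clifford .pos α) * contraction .neg φ) := by
    simp only [Finset.sum_mul, Finset.smul_sum]
    conv_lhs => rw [contraction]
    simp only [projNeg, mul_add, Finset.sum_add_distrib, mul_smul_comm, mul_assoc]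
    rfl
  rw [h', h]
  ext <;> simp

theorem projNeg_add (φ χ : Fin 4 → ℍ[ℝ]) : projNeg (φ + χ) = projNeg φ + projNeg χ := by
  funext α
  simp only [projNeg, contraction, Pi.add_apply, mul_add, Finset.sum_add_distrib, smul_add]
  abel

theorem spinAct_add (c : Chirality) (t : Spin4) (φ χ : Fin 4 → ℍ[ℝ]) :
    spinAct c t (φ + χ) = spinAct c t φ + spinAct c t χ := by
  funext α
  simp only [spinAct, Pi.add_apply, mul_add, smul_add, Finset.sum_add_distrib]

theorem projNeg_pinAct (p : pin2) (φ : Fin 4 → ℍ[ℝ]) :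
    projNeg (pinAct p φ) = pinAct p (projNeg φ) := by
  funext α
  rw [projNeg, contraction_pinAct]
  simp only [pinAct, projNeg, add_mul, smul_mul_assoc, mul_assoc]

theorem pinAct_add (p : pin2) (φ χ : Fin 4 → ℍ[ℝ]) :
    pinAct p (φ + χ) = pinAct p φ + pinAct p χ := by
  funext α
  simp only [pinAct, Pi.add_apply, add_mul]

/-- The complex coefficients stand on the right and the spin action on the left, so only the
equivariance of `ρ(e_α)` is needed. -/
theorem covectorMul_spinAct (t : Spin4) (a b : Fin 4 → ℂ) (ψ : Fin 4 → ℍ[ℝ])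
    (h : ∀ β, b β = ∑ α, rotation t α β • a α) :
    covectorMul a (spinAct .pos t ψ) = spinAct .neg t (covectorMul b ψ) := by
  funext δ
  -- The rotation coefficients are real, hence pass through the embedding of `ℂ` in `ℍ`.
  have hb : ∀ β, (b β : ℍ[ℝ]) = ∑ α, rotation t α β • (a α : ℍ[ℝ]) := fun β => by
    rw [h]
    ext <;> simp [Fin.sum_univ_four]
  simp only [covectorMul, spinAct, chiralPart, Finset.mul_sum, Finset.sum_mul, Finset.smul_sum]
  rw [Finset.sum_comm]
  refine Finset.sum_congr rfl fun β _ => ?_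
  simp only [hb, mul_smul_comm, smul_mul_assoc, ← Finset.smul_sum]
  congr 1
  simp only [Finset.mul_sum]
  rw [Finset.sum_comm]
  refine Finset.sum_congr rfl fun α _ => ?_
  rw [← mul_assoc, ← rotation_smul_clifford_pos]
  simp only [Finset.sum_mul, smul_mul_assoc, mul_smul_comm, mul_assoc]

/-- Right multiplication by `p ∈ Pin(2)` commutes with imaginary scalars up to `pinSign p`. -/
theorem coe_mul_imaginary (p : pin2) (z : ℂ) (hz : z.re = 0) :
    (p : ℍ[ℝ]) * (z : ℍ[ℝ]) = (pinSign p • (z : ℍ[ℝ])) * (p : ℍ[ℝ]) := by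
  obtain ⟨w, hw | hw⟩ := p.2
  · rw [pinSign_complex p w hw, hw]
    ext <;> simp [hz] <;> ring
  · rw [pinSign_j_mul_complex p w hw, hw]
    ext <;> simp [hz, quatJ_parts] <;> ring

theorem pinSign_inv (p : pin2) : pinSign p⁻¹ = pinSign p := by
  obtain ⟨w, hw | hw⟩ := p.2
  · have h1 : pinSign p * pinSign p⁻¹ = 1 := by rw [← map_mul, mul_inv_cancel, map_one]
    rw [pinSign_complex p w hw] at h1 ⊢
    linarith
  · have h1 : pinSign p * pinSign p⁻¹ = 1 := by rw [← map_mul, mul_inv_cancel, map_one]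
    rw [pinSign_j_mul_complex p w hw] at h1 ⊢
    linarith

theorem covectorMul_pinAct (p : pin2) (a : Fin 4 → ℂ) (ha : ∀ α, (a α).re = 0)
    (ψ : Fin 4 → ℍ[ℝ]) :
    covectorMul (fun α => pinSign p • a α) (pinAct p ψ) = pinAct p (covectorMul a ψ) := by
  funext δ
  simp only [covectorMul, pinAct, Finset.sum_mul]
  refine Finset.sum_congr rfl fun α _ => ?_
  -- Moving `p⁻¹` past the scalar costs a second factor `pinSign p`, and the square of the sign is
  -- `1`.
  have h := coe_mul_imaginary p⁻¹ (pinSign p • a α) (by simp [ha])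
  rw [pinSign_inv] at h
  have h2 : pinSign p • ((pinSign p • a α : ℂ) : ℍ[ℝ]) = (a α : ℍ[ℝ]) := by
    have hs : pinSign p * pinSign p = 1 := by
      rw [← map_one pinSign, ← mul_inv_cancel p, map_mul, pinSign_inv]
    have : ((pinSign p • a α : ℂ) : ℍ[ℝ]) = pinSign p • (a α : ℍ[ℝ]) := by
      ext <;> simp
    rw [this, smul_smul, hs, one_smul]
  rw [h2] at h
  rw [← mul_assoc, mul_assoc _ _ ((pinSign p • a α : ℂ) : ℍ[ℝ]), h]
  simp only [mul_assoc]

/-! ### The quadratic map and self-dual forms under a change of spin frame -/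

/-- Invariance of the Euclidean contraction of two vector-indexed families, for an arbitrary
bilinear product; it is applied to the matrix factors of `ψψ*`. -/
theorem sum_rotation_smul_mul_rotation_smul {A : Type*} [Ring A] [Algebra ℝ A] (t : Spin4)
    (f g : Fin 4 → A) :
    ∑ α, (∑ β, rotation t α β • f β) * (∑ β, rotation t α β • g β) = ∑ β, f β * g β := by
  have h : ∀ X : Fin 4 → A, ∑ α, (∑ β, rotation t α β • f β) * X α =
      ∑ β, f β * ∑ α, rotation t α β • X α := fun X => by
    simp only [Finset.sum_mul, Finset.mul_sum, smul_mul_assoc, mul_smul_comm]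
    exact Finset.sum_comm
  rw [h]
  simp only [sum_rotation_smul_sum_rotation_smul']

theorem sum_comm_pairs {E : Type*} [AddCommMonoid E] (f : Fin 4 → Fin 4 → Fin 4 → Fin 4 → E) :
    ∑ a, ∑ b, ∑ c, ∑ d, f a b c d = ∑ c, ∑ d, ∑ a, ∑ b, f a b c d := by
  have h : ∀ a, ∑ b, ∑ c, ∑ d, f a b c d = ∑ c, ∑ d, ∑ b, f a b c d := fun a => by
    rw [Finset.sum_comm]
    exact Finset.sum_congr rfl fun c _ => Finset.sum_comm
  simp only [h]
  rw [Finset.sum_comm]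
  exact Finset.sum_congr rfl fun c _ => Finset.sum_comm

/-! ### Quaternions as complex matrices and the quadratic map. -/

theorem quatMatrix_star (q : ℍ[ℝ]) : quatMatrix (star q) = (quatMatrix q)ᴴ := by
  ext r s
  fin_cases r <;> fin_cases s <;> apply Complex.ext <;> simp [quatMatrix]

theorem quatMatrix_one : quatMatrix 1 = 1 := by
  ext r s
  fin_cases r <;> fin_cases s <;> apply Complex.ext <;> simp [quatMatrix]

/-- `quatMatrix` as a real-linear map. -/
def quatMatrixLinear : ℍ[ℝ] →ₗ[ℝ] Matrix (Fin 2) (Fin 2) ℂ where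
  toFun := quatMatrix
  map_add' p q := by
    ext r s
    fin_cases r <;> fin_cases s <;> apply Complex.ext <;> simp [quatMatrix] <;> ring
  map_smul' c q := by
    ext r s
    fin_cases r <;> fin_cases s <;> apply Complex.ext <;> simp [quatMatrix]

theorem quatMatrix_smul (c : ℝ) (q : ℍ[ℝ]) : quatMatrix (c • q) = c • quatMatrix q :=
  quatMatrixLinear.map_smul c q

theorem quatMatrix_neg (q : ℍ[ℝ]) : quatMatrix (-q) = -quatMatrix q :=
  quatMatrixLinear.map_neg q

theorem quatMatrix_sum {ι : Type*} (s : Finset ι) (f : ι → ℍ[ℝ]) :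
    quatMatrix (∑ i ∈ s, f i) = ∑ i ∈ s, quatMatrix (f i) :=
  map_sum quatMatrixLinear f s

/-- Writing `vv*` as `M E₁₁ M*` makes it a product of two real-linear expressions in the spinor, to
which orthogonality of the rotation applies. -/
theorem vecMulVec_quatColumn (q : ℍ[ℝ]) :
    Matrix.vecMulVec (quatColumn q) (star (quatColumn q)) =
      quatMatrix q * (!![1, 0; 0, 0] * (quatMatrix q)ᴴ) := by
  ext r s
  simp [Matrix.vecMulVec_apply, quatColumn, Matrix.mul_apply, Matrix.vecMul, dotProduct]

theorem quatMatrix_mul_conjTranspose_of_star {q : ℍ[ℝ]} (h : q * star q = 1) :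
    quatMatrix q * (quatMatrix q)ᴴ = 1 := by
  rw [← quatMatrix_star, ← quatMatrix_mul, h, quatMatrix_one]

theorem mu_spinAct (t : Spin4) (ψ : Fin 4 → ℍ[ℝ]) :
    mu (spinAct .pos t ψ) = quatMatrix t.2 * mu ψ * (quatMatrix t.2)ᴴ := by
  have h1 := quatMatrix_mul_conjTranspose_of_star t.snd_mul_star
  have h2 := mul_eq_one_comm.1 h1
  have hT : ∑ α, Matrix.vecMulVec (quatColumn (spinAct .pos t ψ α))
        (star (quatColumn (spinAct .pos t ψ α))) =
      quatMatrix t.2 * (∑ α, Matrix.vecMulVec (quatColumn (ψ α)) (star (quatColumn (ψ α)))) *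
        (quatMatrix t.2)ᴴ := by
    -- The two families are the left factor `M` and the right factor `E₁₁ M*` of the outer products,
    -- so the rotations cancel and only `p₊` survives.
    have := sum_rotation_smul_mul_rotation_smul t (fun β => quatMatrix (t.2 * ψ β))
      (fun β => !![1, 0; 0, 0] * (quatMatrix (t.2 * ψ β))ᴴ)
    simp only [vecMulVec_quatColumn, spinAct, chiralPart, quatMatrix_sum, quatMatrix_smul,
      Matrix.conjTranspose_sum, Matrix.conjTranspose_smul, star_trivial, Finset.mul_sum,
      Finset.sum_mul, mul_smul_comm] at this ⊢
    rw [this]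
    simp only [quatMatrix_mul, Matrix.conjTranspose_mul, mul_assoc]
  have htr : (quatMatrix t.2 * (∑ α, Matrix.vecMulVec (quatColumn (ψ α))
      (star (quatColumn (ψ α)))) * (quatMatrix t.2)ᴴ).trace =
      (∑ α, Matrix.vecMulVec (quatColumn (ψ α)) (star (quatColumn (ψ α)))).trace := by
    rw [Matrix.trace_mul_comm, ← mul_assoc, h2, one_mul]
  simp only [mu]
  rw [hT, htr, mul_sub, sub_mul, mul_smul_comm, mul_one, smul_mul_assoc, h1]

/-- An element of `S¹` is diagonal of unit modulus and fixes the projection `E₁₁`; an element of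
`jS¹` is antidiagonal and exchanges it with `E₂₂`. Both cases are recorded by the one expression in
`pinSign p`. -/
theorem quatMatrix_conj_pin2 (p : pin2) :
    quatMatrix p * !![1, 0; 0, 0] * (quatMatrix p)ᴴ =
      (1 / 2 : ℝ) • 1 + (pinSign p / 2) • !![1, 0; 0, -1] := by
  have hn := norm_unitary p.1
  obtain ⟨w, hw | hw⟩ := p.2
  · rw [pinSign_complex p w hw]
    rw [hw] at hn ⊢
    simp at hn
    ext r s
    fin_cases r <;> fin_cases s <;> apply Complex.ext <;>
      simp [quatMatrix, Matrix.mul_apply] <;> linarith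
  · rw [pinSign_j_mul_complex p w hw]
    rw [hw] at hn ⊢
    simp [quatJ_parts] at hn
    ext r s
    fin_cases r <;> fin_cases s <;> apply Complex.ext <;>
      simp [quatMatrix, Matrix.mul_apply, quatJ_parts] <;> linarith

/-- Since `M(q) M(q)* = |q|²`, subtracting half the trace from `M E₁₁ M*` replaces `E₁₁` by `½
diag(1, -1)`. In this form right multiplication of the spinor is conjugation of the middle matrix.
-/
theorem mu_eq (ψ : Fin 4 → ℍ[ℝ]) :
    mu ψ = (1 / 2 : ℝ) • ∑ α, quatMatrix (ψ α) * !![1, 0; 0, -1] * (quatMatrix (ψ α))ᴴ := by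
  ext r s
  fin_cases r <;> fin_cases s <;> apply Complex.ext <;>
    simp [mu, Matrix.vecMulVec_apply, quatColumn, quatMatrix, Fin.sum_univ_four,
      Matrix.vecMul, dotProduct,
      Matrix.smul_apply] <;> ring

theorem quatMatrix_conj_sigma_pin2 (p : pin2) :
    quatMatrix p * !![1, 0; 0, -1] * (quatMatrix p)ᴴ = pinSign p • !![1, 0; 0, -1] := by
  have h1 := quatMatrix_mul_conjTranspose_of_star (Unitary.coe_mul_star_self p.1)
  have h : (!![1, 0; 0, -1] : Matrix (Fin 2) (Fin 2) ℂ) = (2 : ℝ) • !![1, 0; 0, 0] - 1 := by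
    ext r s
    fin_cases r <;> fin_cases s <;> simp
    norm_num
  conv_lhs => rw [h]
  rw [mul_sub, sub_mul, mul_one, h1, mul_smul_comm, smul_mul_assoc, quatMatrix_conj_pin2]
  module

theorem mu_pinAct (p : pin2) (ψ : Fin 4 → ℍ[ℝ]) : mu (pinAct p ψ) = pinSign p • mu ψ := by
  simp only [mu_eq, pinAct, quatMatrix_mul, Matrix.conjTranspose_mul]
  rw [smul_comm, Finset.smul_sum (r := pinSign p)]
  congr 1
  refine Finset.sum_congr rfl fun α _ => ?_
  have h := quatMatrix_conj_sigma_pin2 p⁻¹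
  rw [pinSign_inv] at h
  calc _ = quatMatrix (ψ α) * (quatMatrix ((p⁻¹ : pin2) : ℍ[ℝ]) * !![1, 0; 0, -1] *
          (quatMatrix ((p⁻¹ : pin2) : ℍ[ℝ]))ᴴ) * (quatMatrix (ψ α))ᴴ := by
        simp only [mul_assoc]
    _ = _ := by rw [h, mul_smul_comm, smul_mul_assoc]

/-! ### Self-dual two-forms as endomorphisms of `W⁺`. -/

theorem rhoInv_smul (r : ℝ) (T : Matrix (Fin 2) (Fin 2) ℂ) :
    rhoInv (r • T) = fun α β => r • rhoInv T α β := by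
  funext α β
  simp only [rhoInv, smul_mul_assoc, Matrix.trace_smul]
  split_ifs
  · simp
  · rw [mul_smul_comm]

/-- For traceless `T` the trace formula vanishes on the diagonal by itself, because `ρ(e_α)² = -1`;
this removes the case distinction. -/
theorem rhoInv_apply {T : Matrix (Fin 2) (Fin 2) ℂ} (hT : T.trace = 0) (α β : Fin 4) :
    rhoInv T α β = -(1 / 4 : ℂ) * (T * quatMatrix (cliffordPair α β)).trace := by
  by_cases h : α = β
  · subst h
    have hc : cliffordPair α α = -1 := by
      rw [cliffordPair_eq]
      fin_cases α <;> rfl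
    rw [hc, quatMatrix_neg, quatMatrix_one]
    simp [rhoInv, hT]
  · simp [rhoInv, h]

theorem sum_rotation_smul_cliffordPair (t : Spin4) (α β : Fin 4) :
    ∑ a, ∑ b, (rotation t a α * rotation t b β) • cliffordPair a b =
      (t.2 : ℍ[ℝ]) * cliffordPair α β * star (t.2 : ℍ[ℝ]) := by
  have h1 : ∑ a, rotation t a α • clifford .neg a =
      (t.2 : ℍ[ℝ]) * clifford .neg α * star (t.1 : ℍ[ℝ]) := by
    rw [← rotation_smul_clifford_neg']
    simp only [Finset.sum_mul, smul_mul_assoc, mul_assoc, t.fst_mul_star, mul_one]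
  have h2 : ∑ b, rotation t b β • clifford .pos b =
      (t.1 : ℍ[ℝ]) * clifford .pos β * star (t.2 : ℍ[ℝ]) := sum_rotation_smul_quatBasis t β
  calc _ = (∑ a, rotation t a α • clifford .neg a) * ∑ b, rotation t b β • clifford .pos b := by
        simp only [Finset.sum_mul_sum, smul_mul_smul_comm, cliffordPair]
    _ = (t.2 : ℍ[ℝ]) * clifford .neg α * (star (t.1 : ℍ[ℝ]) * (t.1 : ℍ[ℝ])) * clifford .pos β *
          star (t.2 : ℍ[ℝ]) := by
        rw [h1, h2]
        simp only [mul_assoc]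
    _ = _ := by rw [t.star_fst_mul, mul_one, cliffordPair, mul_assoc (t.2 : ℍ[ℝ])]

theorem sum_rotation_smul_cliffordPair' (t : Spin4) (a b : Fin 4) :
    ∑ α, ∑ β, (rotation t a α * rotation t b β) • cliffordPair α β =
      star (t.2 : ℍ[ℝ]) * cliffordPair a b * (t.2 : ℍ[ℝ]) := by
  have h2 := sum_rotation_smul_quatBasis' t b
  have h1 := congrArg star (sum_rotation_smul_quatBasis' t a)
  simp only [star_sum, Quaternion.star_smul, star_mul, star_star] at h1
  calc _ = -((∑ α, rotation t a α • star (quatBasis α)) * ∑ β, rotation t b β • quatBasis β) := by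
        simp only [Finset.sum_mul_sum, smul_mul_smul_comm, cliffordPair, clifford, neg_mul,
          smul_neg, Finset.sum_neg_distrib]
    _ = -(star (t.2 : ℍ[ℝ]) * star (quatBasis a) * ((t.1 : ℍ[ℝ]) * star (t.1 : ℍ[ℝ])) *
          quatBasis b * (t.2 : ℍ[ℝ])) := by
        rw [h2, h1]
        simp only [mul_assoc]
    _ = _ := by
        rw [t.fst_mul_star, mul_one, cliffordPair]
        simp only [clifford, neg_mul, mul_neg, mul_assoc]

/-- By cyclicity of the trace, the conjugation moves from `T` to the Clifford pair, where it is the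
rotation of both indices. -/
theorem rhoInv_conj (t : Spin4) {T : Matrix (Fin 2) (Fin 2) ℂ} (hT : T.trace = 0) (α β : Fin 4) :
    rhoInv ((quatMatrix t.2)ᴴ * T * quatMatrix t.2) α β =
      ∑ a, ∑ b, (rotation t a α * rotation t b β) • rhoInv T a b := by
  have h1 := quatMatrix_mul_conjTranspose_of_star t.snd_mul_star
  have htr : ((quatMatrix t.2)ᴴ * T * quatMatrix t.2).trace = 0 := by
    rw [Matrix.trace_mul_comm, ← mul_assoc, h1, one_mul, hT]
  rw [rhoInv_apply htr]
  simp only [rhoInv_apply hT]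
  have h : (quatMatrix t.2)ᴴ * T * quatMatrix t.2 * quatMatrix (cliffordPair α β) =
      (quatMatrix t.2)ᴴ * (T * (quatMatrix t.2 * quatMatrix (cliffordPair α β))) := by
    simp only [mul_assoc]
  rw [h, Matrix.trace_mul_comm, mul_assoc, ← quatMatrix_star, ← quatMatrix_mul, ← quatMatrix_mul,
    ← sum_rotation_smul_cliffordPair]
  simp only [quatMatrix_sum, quatMatrix_smul, Finset.mul_sum, Matrix.trace_sum, mul_smul_comm,
    Matrix.trace_smul]

theorem rhoTwo_trace (η : Fin 4 → Fin 4 → ℂ) : (rhoTwo η).trace = 0 := by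
  rw [rhoTwo_eq, Matrix.trace_fin_two]
  simp

theorem rhoTwo_isHermitian {η : Fin 4 → Fin 4 → ℂ} (h : ∀ α β, (η α β).re = 0) :
    (rhoTwo η).IsHermitian := by
  rw [rhoTwo_eq]
  ext r s
  fin_cases r <;> fin_cases s <;> apply Complex.ext <;> simp [h] <;> ring

theorem rhoTwo_eq_sum {η : Fin 4 → Fin 4 → ℂ} (h : ∀ α β, η β α = -η α β) :
    rhoTwo η = (1 / 2 : ℂ) • ∑ α, ∑ β, η α β • quatMatrix (cliffordPair α β) := by
  have d : ∀ α, η α α = 0 := fun α => self_eq_neg.mp (h α α)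
  rw [rhoTwo_eq]
  ext r s
  fin_cases r <;> fin_cases s <;> apply Complex.ext <;>
    simp [cliffordPair_eq, quatMatrix, quatI_parts, quatJ_parts, quatK_parts, Fin.sum_univ_four,
      Matrix.smul_apply, h 0 1, h 0 2, h 0 3, h 1 2, h 1 3, h 2 3, d] <;> ring

/-- The self-dual part is the projection onto the image of `rhoInv`. -/
theorem selfDualPart_eq_rhoInv {η : Fin 4 → Fin 4 → ℂ} (h : ∀ α β, η β α = -η α β) :
    selfDualPart η = rhoInv (rhoTwo η) := by
  have d : ∀ α, η α α = 0 := fun α => self_eq_neg.mp (h α α)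
  have hs : selfDualPart η = fun α β => (1 / 2 : ℂ) * (η α β + hodge η α β) := rfl
  rw [hs, hodge_eq η h, rhoTwo_eq, rhoInv_eq _ (by simp)]
  ext α β
  fin_cases α <;> fin_cases β <;> apply Complex.ext <;>
    simp [d, h 0 1, h 0 2, h 0 3, h 1 2, h 1 3, h 2 3] <;> ring

/-- Writing the projection as `ρ⁻¹ ∘ ρ` reduces its covariance to conjugation by `p₊`, with no need
for the invariance of the Levi-Civita symbol under rotations. -/
theorem selfDualPart_rotation (t : Spin4) {η η' : Fin 4 → Fin 4 → ℂ} (h : ∀ α β, η β α = -η α β)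
    (h' : ∀ α β, η' α β = ∑ a, ∑ b, (rotation t a α * rotation t b β) • η a b) (α β : Fin 4) :
    selfDualPart η' α β =
      ∑ a, ∑ b, (rotation t a α * rotation t b β) • selfDualPart η a b := by
  have hanti : ∀ α β, η' β α = -η' α β := fun α β => by
    rw [h', h', Finset.sum_comm]
    simp only [← Finset.sum_neg_distrib]
    refine Finset.sum_congr rfl fun a _ => Finset.sum_congr rfl fun b _ => ?_
    rw [h a b, smul_neg, mul_comm]
  rw [selfDualPart_eq_rhoInv h, selfDualPart_eq_rhoInv hanti, ← rhoInv_conj t (rhoTwo_trace η)]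
  congr 1
  rw [rhoTwo_eq_sum h, rhoTwo_eq_sum hanti, mul_smul_comm, smul_mul_assoc]
  congr 1
  simp only [Finset.mul_sum, Finset.sum_mul, mul_smul_comm, smul_mul_assoc]
  have hc : ∀ a b, (quatMatrix t.2)ᴴ * quatMatrix (cliffordPair a b) * quatMatrix t.2 =
      ∑ α, ∑ β, (rotation t a α * rotation t b β) • quatMatrix (cliffordPair α β) := fun a b => by
    rw [← quatMatrix_star, ← quatMatrix_mul, ← quatMatrix_mul, ← sum_rotation_smul_cliffordPair']
    simp only [quatMatrix_sum, quatMatrix_smul]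
  simp only [hc, h', Finset.sum_smul, Finset.smul_sum]
  rw [sum_comm_pairs]
  refine Finset.sum_congr rfl fun a _ => Finset.sum_congr rfl fun b _ =>
    Finset.sum_congr rfl fun α _ => Finset.sum_congr rfl fun β _ => ?_
  rw [smul_assoc, smul_comm]

theorem hodge_sub (η θ : Fin 4 → Fin 4 → ℂ) : hodge (η - θ) = hodge η - hodge θ := by
  funext α β
  simp only [hodge, Pi.sub_apply, mul_sub, Finset.sum_sub_distrib]

theorem IsImSelfDual.sub {η θ : Fin 4 → Fin 4 → ℂ} (hη : IsImSelfDual η) (hθ : IsImSelfDual θ) :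
    IsImSelfDual (η - θ) := by
  obtain ⟨h1, h2, h3⟩ := hη
  obtain ⟨k1, k2, k3⟩ := hθ
  refine ⟨fun α β => by simp [h1, k1], fun α β => ?_, by rw [hodge_sub, h3, k3]⟩
  simp only [Pi.sub_apply, h2 α β, k2 α β]
  ring

theorem isImSelfDual_selfDualPart {η : Fin 4 → Fin 4 → ℂ} (h0 : ∀ α β, (η α β).re = 0)
    (h : ∀ α β, η β α = -η α β) : IsImSelfDual (selfDualPart η) := by
  rw [selfDualPart_eq_rhoInv h]
  exact isImSelfDual_rhoInv _ (rhoTwo_isHermitian h0) (rhoTwo_trace η)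

theorem selfDualPart_smul (r : ℝ) (η : Fin 4 → Fin 4 → ℂ) :
    selfDualPart (fun α β => r • η α β) = fun α β => r • selfDualPart η α β := by
  funext α β
  simp only [selfDualPart, hodge, Complex.real_smul, mul_add, Finset.mul_sum]
  congr 1
  · ring
  · exact Finset.sum_congr rfl fun γ _ => Finset.sum_congr rfl fun δ _ => by ring

/-! ### The spin connection form -/

/-- The value `1/4 ∑ Γ_{βγ} ρ(e_β) ρ(e_γ)` of the spin connection form. -/
def spinConnection (Γ : Fin 4 → Fin 4 → ℝ) : ℍ[ℝ] :=
  (1 / 4 : ℝ) • ∑ β, ∑ γ, Γ β γ • cliffordPair β γ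

/-- The derivative of `rotation t` when the components of `t` have derivatives `dp` and `dq`. -/
def rotationDeriv (t : Spin4) (dp dq : ℍ[ℝ]) (α β : Fin 4) : ℝ :=
  inner ℝ (quatBasis α) (dp * quatBasis β * star (t.2 : ℍ[ℝ]) + (t.1 : ℍ[ℝ]) * quatBasis β * star dq)

/-- Components of the Maurer-Cartan form of the rotation group along the lift to `Spin(4)`. -/
theorem spinConnection_rotationDeriv (t : Spin4) {dp dq : ℍ[ℝ]}
    (hp : star (t.1 : ℍ[ℝ]) * dp + star dp * (t.1 : ℍ[ℝ]) = 0)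
    (hq : star (t.2 : ℍ[ℝ]) * dq + star dq * (t.2 : ℍ[ℝ]) = 0) :
    spinConnection (fun β γ => ∑ c, rotationDeriv t dp dq c β * rotation t c γ) =
      star (t.2 : ℍ[ℝ]) * dq := by
  -- Differentiating `p̄₋ p₋ = 1` shows that `p̄₋ dp₋` has no real part.
  have hre : (star (t.1 : ℍ[ℝ]) * dp).re = 0 := by
    have := congrArg QuaternionAlgebra.re hp
    rw [Quaternion.re_add, ← star_star (star dp * (t.1 : ℍ[ℝ])), Quaternion.re_star, star_mul,
      star_star, Quaternion.re_zero] at this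
    linarith
  -- The sum over `γ` splits into a `p₋` term, whose sum over `β` is a multiple of the vanishing
  -- real part, and a `p₊` term, whose sum is `4 p̄₊ dp₊`; the `4` cancels the factor `1/4`.
  have hsum : ∀ β, ∑ γ, (∑ c, rotationDeriv t dp dq c β * rotation t c γ) • cliffordPair β γ =
      -(star (quatBasis β) * (star (t.1 : ℍ[ℝ]) * dp * quatBasis β)) +
        star (quatBasis β) * quatBasis β * (star (t.2 : ℍ[ℝ]) * dq) := fun β => by
    calc _ = -(star (quatBasis β) * ∑ c, rotationDeriv t dp dq c β •
            ∑ γ, rotation t c γ • quatBasis γ) := by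
          simp only [Finset.sum_smul, mul_smul, cliffordPair, clifford, neg_mul, smul_neg,
            Finset.sum_neg_distrib, Finset.mul_sum, mul_smul_comm, Finset.smul_sum]
          rw [Finset.sum_comm]
      _ = -(star (quatBasis β) * (star (t.1 : ℍ[ℝ]) * (dp * quatBasis β * star (t.2 : ℍ[ℝ]) +
            (t.1 : ℍ[ℝ]) * quatBasis β * star dq) * (t.2 : ℍ[ℝ]))) := by
          rw [← sum_inner_quatBasis_smul (dp * quatBasis β * star (t.2 : ℍ[ℝ]) + _)]
          simp only [sum_rotation_smul_quatBasis', Finset.mul_sum, Finset.sum_mul, mul_smul_comm,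
            smul_mul_assoc]
          rfl
      _ = -(star (quatBasis β) * (star (t.1 : ℍ[ℝ]) * dp * quatBasis β *
              (star (t.2 : ℍ[ℝ]) * (t.2 : ℍ[ℝ])) +
            (star (t.1 : ℍ[ℝ]) * (t.1 : ℍ[ℝ])) * quatBasis β * (star dq * (t.2 : ℍ[ℝ])))) := by
          simp only [mul_add, add_mul, mul_assoc]
      _ = _ := by
          rw [t.star_fst_mul, t.star_snd_mul, eq_neg_of_add_eq_zero_right hq]
          simp only [mul_one, one_mul, mul_neg, mul_add, neg_add, neg_neg, mul_assoc]
  rw [spinConnection]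
  simp only [hsum, Finset.sum_add_distrib, Finset.sum_neg_distrib, ← Finset.sum_mul,
    sum_star_quatBasis_mul_mul, hre, sum_star_quatBasis_mul]
  ext <;> simp

theorem spinConnection_rotation (t : Spin4) (Γ : Fin 4 → Fin 4 → ℝ) :
    spinConnection (fun β γ => ∑ b, ∑ c, rotation t b β * rotation t c γ * Γ b c) =
      star (t.2 : ℍ[ℝ]) * spinConnection Γ * (t.2 : ℍ[ℝ]) := by
  simp only [spinConnection, mul_smul_comm, smul_mul_assoc]
  congr 1
  simp only [Finset.mul_sum, Finset.sum_mul, mul_smul_comm, smul_mul_assoc,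
    ← sum_rotation_smul_cliffordPair', Finset.sum_smul, Finset.smul_sum, smul_smul]
  rw [sum_comm_pairs]
  refine Finset.sum_congr rfl fun a _ => Finset.sum_congr rfl fun b _ =>
    Finset.sum_congr rfl fun α _ => Finset.sum_congr rfl fun β _ => ?_
  rw [mul_comm]

theorem spinConnection_add (Γ Δ : Fin 4 → Fin 4 → ℝ) :
    spinConnection (fun β γ => Γ β γ + Δ β γ) = spinConnection Γ + spinConnection Δ := by
  simp only [spinConnection, add_smul, Finset.sum_add_distrib, smul_add]

/-! ### Directional derivatives and Lie brackets on `X` -/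

universe u v

section Calculus

open VectorField Topology

variable {X : Type u} [TopologicalSpace X] [ChartedSpace (EuclideanSpace ℝ (Fin 4)) X]
variable {F G H : Type*} [NormedAddCommGroup F] [NormedSpace ℝ F] [NormedAddCommGroup G]
  [NormedSpace ℝ G] [NormedAddCommGroup H] [NormedSpace ℝ H]

/-- The derivative of a vector-valued function along a tangent vector. -/
def dirDeriv {x : X} (w : TangentSpace (𝓡 4) x) (f : X → F) : F :=
  mfderiv (𝓡 4) 𝓘(ℝ, F) f x w

theorem dirDeriv_sum_smul {x : X} {ι : Type*} (s : Finset ι) (c : ι → ℝ)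
    (w : ι → TangentSpace (𝓡 4) x) (f : X → F) :
    dirDeriv (∑ a ∈ s, c a • w a) f = ∑ a ∈ s, c a • dirDeriv (w a) f := by
  unfold dirDeriv
  rw [map_sum]
  exact Finset.sum_congr rfl fun a _ => map_smul _ _ _

theorem dirDeriv_congr {x : X} (w : TangentSpace (𝓡 4) x) {f f' : X → F} (h : f =ᶠ[𝓝 x] f') :
    dirDeriv w f = dirDeriv w f' := by
  unfold dirDeriv
  rw [h.mfderiv_eq]
  rfl

theorem dirDeriv_const {x : X} (w : TangentSpace (𝓡 4) x) (c : F) :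
    dirDeriv w (fun _ : X => c) = 0 := by
  unfold dirDeriv
  rw [mfderiv_const]
  rfl

theorem hasMFDerivAt_bilin (B : F →L[ℝ] G →L[ℝ] H) {x : X} {f : X → F} {k : X → G}
    (hf : MDifferentiableAt (𝓡 4) 𝓘(ℝ, F) f x) (hk : MDifferentiableAt (𝓡 4) 𝓘(ℝ, G) k x) :
    HasMFDerivAt (𝓡 4) 𝓘(ℝ, H) (fun y => B (f y) (k y)) x
      ((B.deriv₂ (f x, k x)).comp (ContinuousLinearMap.prod (M₂ := F) (M₃ := G)
        (mfderiv (𝓡 4) 𝓘(ℝ, F) f x) (mfderiv (𝓡 4) 𝓘(ℝ, G) k x))) := by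
  have h1 : HasMFDerivAt (𝓡 4) 𝓘(ℝ, F × G) (fun y => (f y, k y)) x
      (ContinuousLinearMap.prod (M₂ := F) (M₃ := G) (mfderiv (𝓡 4) 𝓘(ℝ, F) f x)
        (mfderiv (𝓡 4) 𝓘(ℝ, G) k x)) :=
    ⟨hf.continuousAt.prodMk hk.continuousAt, hf.hasMFDerivAt.2.prodMk hk.hasMFDerivAt.2⟩
  have h2 : HasMFDerivAt 𝓘(ℝ, F × G) 𝓘(ℝ, H) (fun p : F × G => B p.1 p.2) (f x, k x)
      (B.deriv₂ (f x, k x)) :=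
    (B.isBoundedBilinearMap.hasFDerivAt (f x, k x)).hasMFDerivAt
  exact HasMFDerivAt.comp x h2 h1

theorem dirDeriv_bilin {x : X} (w : TangentSpace (𝓡 4) x) (B : F →L[ℝ] G →L[ℝ] H) {f : X → F}
    {k : X → G} (hf : MDifferentiableAt (𝓡 4) 𝓘(ℝ, F) f x)
    (hk : MDifferentiableAt (𝓡 4) 𝓘(ℝ, G) k x) :
    dirDeriv w (fun y => B (f y) (k y)) = B (dirDeriv w f) (k x) + B (f x) (dirDeriv w k) := by
  unfold dirDeriv
  rw [(hasMFDerivAt_bilin B hf hk).mfderiv]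
  exact add_comm _ _

theorem dirDeriv_clm {x : X} (w : TangentSpace (𝓡 4) x) (L : F →L[ℝ] G) {f : X → F}
    (hf : MDifferentiableAt (𝓡 4) 𝓘(ℝ, F) f x) :
    dirDeriv w (fun y => L (f y)) = L (dirDeriv w f) := by
  have h3 := HasMFDerivAt.comp x L.hasMFDerivAt hf.hasMFDerivAt
  unfold dirDeriv
  rw [show (fun y => L (f y)) = L ∘ f from rfl, h3.mfderiv]
  rfl

theorem dirDeriv_add {x : X} (w : TangentSpace (𝓡 4) x) {f f' : X → F}
    (hf : MDifferentiableAt (𝓡 4) 𝓘(ℝ, F) f x) (hf' : MDifferentiableAt (𝓡 4) 𝓘(ℝ, F) f' x) :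
    dirDeriv w (fun y => f y + f' y) = dirDeriv w f + dirDeriv w f' :=
  congrArg (fun L : TangentSpace (𝓡 4) x →L[ℝ] F => L w) (mvfderiv_add hf hf')

/-- Differentiability of the partial sums is carried along because the induction step for the
derivative requires it. -/
theorem dirDeriv_sum {x : X} (w : TangentSpace (𝓡 4) x) {ι : Type*} (s : Finset ι)
    {f : ι → X → F} (hf : ∀ a, MDifferentiableAt (𝓡 4) 𝓘(ℝ, F) (f a) x) :
    dirDeriv w (fun y => ∑ a ∈ s, f a y) = ∑ a ∈ s, dirDeriv w (f a) ∧
      MDifferentiableAt (𝓡 4) 𝓘(ℝ, F) (fun y => ∑ a ∈ s, f a y) x := by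
  classical
  induction s using Finset.induction_on with
  | empty => simpa using! ⟨dirDeriv_const w (0 : F), mdifferentiableAt_const⟩
  | insert a s ha ih =>
    simp only [Finset.sum_insert ha]
    exact ⟨by rw [dirDeriv_add w (hf a) ih.2, ih.1], (hf a).add ih.2⟩

theorem dirDeriv_smul {x : X} (w : TangentSpace (𝓡 4) x) {f : X → ℝ} {k : X → F}
    (hf : MDifferentiableAt (𝓡 4) 𝓘(ℝ, ℝ) f x) (hk : MDifferentiableAt (𝓡 4) 𝓘(ℝ, F) k x) :
    dirDeriv w (fun y => f y • k y) = dirDeriv w f • k x + f x • dirDeriv w k :=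
  dirDeriv_bilin w (ContinuousLinearMap.lsmul ℝ ℝ) hf hk

theorem dirDeriv_mul {x : X} (w : TangentSpace (𝓡 4) x) {f k : X → ℍ[ℝ]}
    (hf : MDifferentiableAt (𝓡 4) 𝓘(ℝ, ℍ[ℝ]) f x) (hk : MDifferentiableAt (𝓡 4) 𝓘(ℝ, ℍ[ℝ]) k x) :
    dirDeriv w (fun y => f y * k y) = dirDeriv w f * k x + f x * dirDeriv w k :=
  dirDeriv_bilin w (ContinuousLinearMap.mul ℝ ℍ[ℝ]) hf hk

/-- Quaternionic conjugation as a real continuous linear map. -/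
def starQuaternionL : ℍ[ℝ] →L[ℝ] ℍ[ℝ] := 
  LinearMap.toContinuousLinearMap
    { toFun := star
      map_add' := star_add
      map_smul' := fun c q => Quaternion.star_smul c q }

theorem dirDeriv_star {x : X} (w : TangentSpace (𝓡 4) x) {f : X → ℍ[ℝ]}
    (hf : MDifferentiableAt (𝓡 4) 𝓘(ℝ, ℍ[ℝ]) f x) :
    dirDeriv w (fun y => star (f y)) = star (dirDeriv w f) :=
  dirDeriv_clm w starQuaternionL hf

theorem mdifferentiableAt_quaternion_mul {x : X} {f k : X → ℍ[ℝ]}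
    (hf : MDifferentiableAt (𝓡 4) 𝓘(ℝ, ℍ[ℝ]) f x) (hk : MDifferentiableAt (𝓡 4) 𝓘(ℝ, ℍ[ℝ]) k x) :
    MDifferentiableAt (𝓡 4) 𝓘(ℝ, ℍ[ℝ]) (fun y => f y * k y) x :=
  (hasMFDerivAt_bilin (ContinuousLinearMap.mul ℝ ℍ[ℝ]) hf hk).mdifferentiableAt

theorem mdifferentiableAt_clm {x : X} (L : F →L[ℝ] G) {f : X → F}
    (hf : MDifferentiableAt (𝓡 4) 𝓘(ℝ, F) f x) :
    MDifferentiableAt (𝓡 4) 𝓘(ℝ, G) (fun y => L (f y)) x :=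
  L.differentiableAt.comp_mdifferentiableAt hf

variable [IsManifold (𝓡 4) ∞ X]

/-! ### Smooth vector fields, their brackets and the metric. -/

instance : IsManifold (𝓡 4) (minSmoothness ℝ 3) X := by
  rw [minSmoothness_of_isRCLikeNormedField]
  infer_instance

/-- The directional derivative is the fibre component of the tangent map of `f` composed with the
vector field. -/
theorem contMDiffOn_dirDeriv {U : Set X} (hU : IsOpen U) {V : (x : X) → TangentSpace (𝓡 4) x}
    (hV : ContMDiffOn (𝓡 4) (𝓡 4).tangent ∞ (fun x => (⟨x, V x⟩ : TangentBundle (𝓡 4) X)) U)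
    {f : X → F} (hf : ContMDiffOn (𝓡 4) 𝓘(ℝ, F) ∞ f U) :
    ContMDiffOn (𝓡 4) 𝓘(ℝ, F) ∞ (fun x => dirDeriv (V x) f) U := by
  have h1 := hf.contMDiffOn_tangentMapWithin (m := ∞) (by simp) hU.uniqueMDiffOn
  have h2 := (contMDiff_snd_tangentBundle_modelSpace (n := ∞) F 𝓘(ℝ, F)).comp_contMDiffOn
    (h1.comp hV fun x hx => hx)
  refine h2.congr fun x hx => ?_
  change _ = mfderivWithin (𝓡 4) 𝓘(ℝ, F) f U x (V x)
  rw [mfderivWithin_of_isOpen hU hx]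
  rfl

theorem contMDiffOn_mlieBracket {U : Set X} (hU : IsOpen U) {V W : (x : X) → TangentSpace (𝓡 4) x}
    (hV : ContMDiffOn (𝓡 4) (𝓡 4).tangent ∞ (fun x => (⟨x, V x⟩ : TangentBundle (𝓡 4) X)) U)
    (hW : ContMDiffOn (𝓡 4) (𝓡 4).tangent ∞ (fun x => (⟨x, W x⟩ : TangentBundle (𝓡 4) X)) U) :
    ContMDiffOn (𝓡 4) (𝓡 4).tangent ∞
      (fun x => (⟨x, mlieBracket (𝓡 4) V W x⟩ : TangentBundle (𝓡 4) X)) U := by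
  intro x hx
  have : IsManifold (𝓡 4) (((⊤ : ℕ∞) : WithTop ℕ∞) + 1) X := by simpa using! ‹IsManifold (𝓡 4) ∞ X›
  refine (ContMDiffAt.mlieBracket_vectorField (m := ⊤) (n := ⊤)
    ((hV x hx).contMDiffAt (hU.mem_nhds hx)) ((hW x hx).contMDiffAt (hU.mem_nhds hx))
    (by simp)).contMDiffWithinAt

theorem contMDiffOn_metric (g : RiemMetric X) {U : Set X} {V W : (x : X) → TangentSpace (𝓡 4) x}
    (hV : ContMDiffOn (𝓡 4) (𝓡 4).tangent ∞ (fun x => (⟨x, V x⟩ : TangentBundle (𝓡 4) X)) U)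
    (hW : ContMDiffOn (𝓡 4) (𝓡 4).tangent ∞ (fun x => (⟨x, W x⟩ : TangentBundle (𝓡 4) X)) U) :
    ContMDiffOn (𝓡 4) 𝓘(ℝ, ℝ) ∞ (fun x => g.inner x (V x) (W x)) U := by
  intro x hx
  have : ContMDiffWithinAt (𝓡 4) ((𝓡 4).prod 𝓘(ℝ)) ∞
      (fun m ↦ Bundle.TotalSpace.mk' ℝ (E := Bundle.Trivial X ℝ) m (g.inner m (V m) (W m))) U x := by
    apply ContMDiffWithinAt.clm_bundle_apply₂ (F₁ := EuclideanSpace ℝ (Fin 4))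
      (F₂ := EuclideanSpace ℝ (Fin 4))
    · exact g.contMDiff.contMDiffAt.contMDiffWithinAt
    · exact hV x hx
    · exact hW x hx
  simp only [Bundle.contMDiffWithinAt_totalSpace] at this
  exact this.2

theorem mlieBracket_sum_right {x : X} {ι : Type*} (s : Finset ι) {V : (x : X) → TangentSpace (𝓡 4) x}
    {W : ι → (x : X) → TangentSpace (𝓡 4) x}
    (hW : ∀ a, MDifferentiableAt (𝓡 4) (𝓡 4).tangent
      (fun x => (⟨x, W a x⟩ : TangentBundle (𝓡 4) X)) x) :
    mlieBracket (𝓡 4) V (fun y => ∑ a ∈ s, W a y) x = ∑ a ∈ s, mlieBracket (𝓡 4) V (W a) x := by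
  classical
  induction s using Finset.induction_on with
  | empty => exact congrFun mlieBracket_zero_right x
  | insert a s ha ih =>
    rw [Finset.sum_insert ha, ← ih, ← mlieBracket_add_right (hW a)
      (MDifferentiableAt.sum_section fun b _ => hW b)]
    congr 1
    funext y
    simp [Finset.sum_insert ha]

theorem mlieBracket_sum_smul_right {x : X} {ι : Type*} (s : Finset ι)
    {V : (x : X) → TangentSpace (𝓡 4) x} {W : ι → (x : X) → TangentSpace (𝓡 4) x} {c : ι → X → ℝ}
    (hW : ∀ a, MDifferentiableAt (𝓡 4) (𝓡 4).tangent
      (fun x => (⟨x, W a x⟩ : TangentBundle (𝓡 4) X)) x)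
    (hc : ∀ a, MDifferentiableAt (𝓡 4) 𝓘(ℝ, ℝ) (c a) x) :
    mlieBracket (𝓡 4) V (fun y => ∑ a ∈ s, c a y • W a y) x =
      ∑ a ∈ s, (dirDeriv (V x) (c a) • W a x + c a x • mlieBracket (𝓡 4) V (W a) x) := by
  rw [mlieBracket_sum_right s (W := fun a y => c a y • W a y)
    (fun a => (hc a).smul_section (hW a))]
  exact Finset.sum_congr rfl fun a _ => mlieBracket_smul_right (hc a) (hW a)

/-- The Leibniz rule in both arguments, in the form needed for brackets of the vectors of a rotated
frame. -/
theorem mlieBracket_sum_smul_sum_smul {x : X} {W : Fin 4 → (x : X) → TangentSpace (𝓡 4) x}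
    {c d : Fin 4 → X → ℝ}
    (hW : ∀ a, MDifferentiableAt (𝓡 4) (𝓡 4).tangent
      (fun x => (⟨x, W a x⟩ : TangentBundle (𝓡 4) X)) x)
    (hc : ∀ a, MDifferentiableAt (𝓡 4) 𝓘(ℝ, ℝ) (c a) x)
    (hd : ∀ a, MDifferentiableAt (𝓡 4) 𝓘(ℝ, ℝ) (d a) x) :
    mlieBracket (𝓡 4) (fun y => ∑ a, c a y • W a y) (fun y => ∑ b, d b y • W b y) x =
      (∑ b, dirDeriv (∑ a, c a x • W a x) (d b) • W b x) -
        (∑ a, dirDeriv (∑ b, d b x • W b x) (c a) • W a x) +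
        ∑ a, ∑ b, (c a x * d b x) • mlieBracket (𝓡 4) (W a) (W b) x := by
  rw [mlieBracket_sum_smul_right _ hW hd]
  -- The rule in the first argument comes from the second by antisymmetry, used once to exchange the
  -- arguments and once to restore them.
  have h : ∀ b, mlieBracket (𝓡 4) (fun y => ∑ a, c a y • W a y) (W b) x =
      ∑ a, (-(dirDeriv (W b x) (c a) • W a x) + c a x • mlieBracket (𝓡 4) (W a) (W b) x) :=
    fun b => by
    rw [mlieBracket_swap_apply, mlieBracket_sum_smul_right _ hW hc, ← Finset.sum_neg_distrib]
    refine Finset.sum_congr rfl fun a _ => ?_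
    rw [neg_add, mlieBracket_swap_apply (V := W b), smul_neg, neg_neg]
  simp only [h, Finset.sum_add_distrib, dirDeriv_sum_smul, Finset.smul_sum, smul_add, smul_neg,
    Finset.sum_neg_distrib, smul_smul, Finset.sum_smul, smul_eq_mul]
  rw [Finset.sum_comm (f := fun a b => (d a x * dirDeriv (W a x) (c b)) • W b x),
    Finset.sum_comm (f := fun a b => (d a x * c b x) • mlieBracket (𝓡 4) (W b) (W a) x)]
  simp only [mul_comm (d _ x) (c _ x)]
  abel

end Calculus

/-! ### Change of spin frame -/

namespace SpinStructure

open VectorField Topology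

variable {X : Type u} [TopologicalSpace X] [ChartedSpace (EuclideanSpace ℝ (Fin 4)) X]
  [IsManifold (𝓡 4) ∞ X] {g : RiemMetric X} (s : SpinStructure.{u, v} g)

theorem mem_nhds_inter {i j : s.ι} {x : X} (hx : x ∈ s.U i ∩ s.U j) : s.U i ∩ s.U j ∈ 𝓝 x :=
  ((s.isOpen_U i).inter (s.isOpen_U j)).mem_nhds hx

section Transition

variable {i j : s.ι} {x : X}

theorem mdifferentiableAt_trans_fst (hx : x ∈ s.U i ∩ s.U j) :
    MDifferentiableAt (𝓡 4) 𝓘(ℝ, ℍ[ℝ]) (fun y => ((s.trans i j y).1 : ℍ[ℝ])) x :=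
  mdifferentiableAt_clm (ContinuousLinearMap.fst ℝ ℍ[ℝ] ℍ[ℝ])
    (((s.smooth_trans i j x hx).contMDiffAt (s.mem_nhds_inter hx)).mdifferentiableAt (by simp))

theorem mdifferentiableAt_trans_snd (hx : x ∈ s.U i ∩ s.U j) :
    MDifferentiableAt (𝓡 4) 𝓘(ℝ, ℍ[ℝ]) (fun y => ((s.trans i j y).2 : ℍ[ℝ])) x :=
  mdifferentiableAt_clm (ContinuousLinearMap.snd ℝ ℍ[ℝ] ℍ[ℝ])
    (((s.smooth_trans i j x hx).contMDiffAt (s.mem_nhds_inter hx)).mdifferentiableAt (by simp))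

theorem mdifferentiableAt_frame (α : Fin 4) (hx : x ∈ s.U i) :
    MDifferentiableAt (𝓡 4) (𝓡 4).tangent
      (fun y => (⟨y, s.frame i α y⟩ : TangentBundle (𝓡 4) X)) x :=
  ((s.smooth_frame i α x hx).contMDiffAt ((s.isOpen_U i).mem_nhds hx)).mdifferentiableAt (by simp)

variable (i j) in
/-- The derivative of `p₋` along `e_a`. -/
def transFstDeriv (a : Fin 4) (x : X) : ℍ[ℝ] :=
  dirDeriv (s.frame i a x) (fun y => ((s.trans i j y).1 : ℍ[ℝ]))

variable (i j) in
/-- The derivative of `p₊` along `e_a`. -/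
def transSndDeriv (a : Fin 4) (x : X) : ℍ[ℝ] :=
  dirDeriv (s.frame i a x) (fun y => ((s.trans i j y).2 : ℍ[ℝ]))

variable (i j) in
/-- The derivative along `e_a` of the rotation between two frames. -/
def transRotationDeriv (a : Fin 4) (x : X) : Fin 4 → Fin 4 → ℝ :=
  rotationDeriv (s.trans i j x) (s.transFstDeriv i j a x) (s.transSndDeriv i j a x)

theorem dirDeriv_rotation (hx : x ∈ s.U i ∩ s.U j) (w : TangentSpace (𝓡 4) x) (α β : Fin 4) :
    dirDeriv w (fun y => rotation (s.trans i j y) α β) =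
        rotationDeriv (s.trans i j x) (dirDeriv w (fun y => ((s.trans i j y).1 : ℍ[ℝ])))
          (dirDeriv w (fun y => ((s.trans i j y).2 : ℍ[ℝ]))) α β ∧
      MDifferentiableAt (𝓡 4) 𝓘(ℝ, ℝ) (fun y => rotation (s.trans i j y) α β) x := by
  have hp := s.mdifferentiableAt_trans_fst hx
  have hq := s.mdifferentiableAt_trans_snd hx
  have hc : MDifferentiableAt (𝓡 4) 𝓘(ℝ, ℍ[ℝ]) (fun _ : X => quatBasis β) x :=
    mdifferentiableAt_const
  have hq' : MDifferentiableAt (𝓡 4) 𝓘(ℝ, ℍ[ℝ]) (fun y => star ((s.trans i j y).2 : ℍ[ℝ])) x :=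
    mdifferentiableAt_clm starQuaternionL hq
  have hpc := mdifferentiableAt_quaternion_mul hp hc
  have h := mdifferentiableAt_quaternion_mul hpc hq'
  have hL := dirDeriv_clm w (innerSL ℝ (quatBasis α)) h
  refine ⟨?_, mdifferentiableAt_clm (innerSL ℝ (quatBasis α)) h⟩
  refine hL.trans ?_
  rw [dirDeriv_mul w hpc hq', dirDeriv_mul w hp hc, dirDeriv_star w hq, dirDeriv_const]
  simp only [mul_zero, add_zero]
  rfl

theorem mdifferentiableAt_rotation (hx : x ∈ s.U i ∩ s.U j) (α β : Fin 4) :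
    MDifferentiableAt (𝓡 4) 𝓘(ℝ, ℝ) (fun y => rotation (s.trans i j y) α β) x :=
  -- The direction is a dummy: differentiability does not depend on it.
  (s.dirDeriv_rotation hx 0 α β).2

theorem dirDeriv_frame_rotation (hx : x ∈ s.U i ∩ s.U j) (a α β : Fin 4) :
    dirDeriv (s.frame i a x) (fun y => rotation (s.trans i j y) α β) =
      s.transRotationDeriv i j a x α β :=
  (s.dirDeriv_rotation hx _ α β).1

theorem star_mul_transFstDeriv (hx : x ∈ s.U i ∩ s.U j) (a : Fin 4) :
    star ((s.trans i j x).1 : ℍ[ℝ]) * s.transFstDeriv i j a x +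
      star (s.transFstDeriv i j a x) * ((s.trans i j x).1 : ℍ[ℝ]) = 0 := by
  have hp := s.mdifferentiableAt_trans_fst hx
  have h := dirDeriv_mul (s.frame i a x) (mdifferentiableAt_clm starQuaternionL hp) hp
  -- The transition function has unit values everywhere, so the differentiated product is globally
  -- constant.
  have h1 : (fun y => starQuaternionL ((s.trans i j y).1 : ℍ[ℝ]) * ((s.trans i j y).1 : ℍ[ℝ])) =
      fun _ : X => (1 : ℍ[ℝ]) := by
    funext y
    exact (s.trans i j y).star_fst_mul
  rw [h1, dirDeriv_const, dirDeriv_clm _ _ hp] at h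
  rw [add_comm]
  exact h.symm

theorem star_mul_transSndDeriv (hx : x ∈ s.U i ∩ s.U j) (a : Fin 4) :
    star ((s.trans i j x).2 : ℍ[ℝ]) * s.transSndDeriv i j a x +
      star (s.transSndDeriv i j a x) * ((s.trans i j x).2 : ℍ[ℝ]) = 0 := by
  have hp := s.mdifferentiableAt_trans_snd hx
  have h := dirDeriv_mul (s.frame i a x) (mdifferentiableAt_clm starQuaternionL hp) hp
  have h1 : (fun y => starQuaternionL ((s.trans i j y).2 : ℍ[ℝ]) * ((s.trans i j y).2 : ℍ[ℝ])) =
      fun _ : X => (1 : ℍ[ℝ]) := by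
    funext y
    exact (s.trans i j y).star_snd_mul
  rw [h1, dirDeriv_const, dirDeriv_clm _ _ hp] at h
  rw [add_comm]
  exact h.symm

/-- Obtained by differentiating `RᵀR = 1`: the form `RᵀdR` takes values in `so(4)`. -/
theorem sum_transRotationDeriv_antisymm (hx : x ∈ s.U i ∩ s.U j) (a β γ : Fin 4) :
    ∑ c, s.transRotationDeriv i j a x c β * rotation (s.trans i j x) c γ =
      -∑ c, s.transRotationDeriv i j a x c γ * rotation (s.trans i j x) c β := by
  have hR := s.mdifferentiableAt_rotation hx
  have h := (dirDeriv_sum (s.frame i a x) Finset.univ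
    (f := fun c y => rotation (s.trans i j y) c β • rotation (s.trans i j y) c γ)
    fun c => (hR c β).smul (hR c γ)).1
  have h1 : (fun y => ∑ c, rotation (s.trans i j y) c β • rotation (s.trans i j y) c γ) =
      fun _ : X => if β = γ then (1 : ℝ) else 0 := by
    funext y
    exact sum_rotation_mul_rotation (s.trans i j y) β γ
  rw [h1, dirDeriv_const] at h
  have h2 : ∀ c, dirDeriv (s.frame i a x)
      (fun y => rotation (s.trans i j y) c β • rotation (s.trans i j y) c γ) =
      s.transRotationDeriv i j a x c β * rotation (s.trans i j x) c γ +
        s.transRotationDeriv i j a x c γ * rotation (s.trans i j x) c β := fun c => by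
    rw [dirDeriv_smul _ (hR c β) (hR c γ), s.dirDeriv_frame_rotation hx,
      s.dirDeriv_frame_rotation hx, smul_eq_mul, smul_eq_mul, mul_comm (rotation _ _ _)]
  rw [Finset.sum_congr rfl fun c _ => h2 c, Finset.sum_add_distrib] at h
  rw [eq_neg_iff_add_eq_zero, h]

theorem frameDeriv_trans {F : Type*} [NormedAddCommGroup F] [NormedSpace ℝ F]
    (hx : x ∈ s.U i ∩ s.U j) (α : Fin 4) (f : X → F) :
    s.frameDeriv j α f x = ∑ a, rotation (s.trans i j x) a α • s.frameDeriv i a f x := by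
  have h : s.frameDeriv j α f x = dirDeriv (s.frame j α x) f := rfl
  rw [h, s.frame_trans i j x hx, dirDeriv_sum_smul]
  rfl

theorem bracket_trans (hx : x ∈ s.U i ∩ s.U j) (α β : Fin 4) :
    s.bracket j α β x =
      (∑ b, (∑ a, rotation (s.trans i j x) a α * s.transRotationDeriv i j a x b β) •
        s.frame i b x) -
      (∑ b, (∑ a, rotation (s.trans i j x) a β * s.transRotationDeriv i j a x b α) •
        s.frame i b x) +
      ∑ a, ∑ b, (rotation (s.trans i j x) a α * rotation (s.trans i j x) b β) •
        s.bracket i a b x := by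
  -- The bracket depends on the fields near `x`, so the relation between the frames is used as an
  -- equality of germs.
  have he : ∀ α, s.frame j α =ᶠ[𝓝 x]
      fun y => ∑ a, rotation (s.trans i j y) a α • s.frame i a y := fun α =>
    Filter.eventually_of_mem (s.mem_nhds_inter hx) fun y hy => s.frame_trans i j y hy α
  refine (Filter.EventuallyEq.mlieBracket_vectorField_eq (he α) (he β)).trans
    ((mlieBracket_sum_smul_sum_smul (fun a => s.mdifferentiableAt_frame a hx.1)
      (fun a => s.mdifferentiableAt_rotation hx a α)
      (fun a => s.mdifferentiableAt_rotation hx a β)).trans ?_)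
  simp only [dirDeriv_sum_smul, s.dirDeriv_frame_rotation hx, smul_eq_mul]
  rfl

/-! ### Structure functions and Levi-Civita coefficients in two frames. -/

theorem inner_sum_smul_frame (hx : x ∈ s.U i) (c : Fin 4 → ℝ) (γ : Fin 4) :
    g.inner x (∑ b, c b • s.frame i b x) (s.frame i γ x) = c γ := by
  simp [map_sum, s.orthonormal i x hx]

/-- The structure functions `g([e_α, e_β], e_γ)` of a frame. -/
def structureFunction (i : s.ι) (α β γ : Fin 4) (x : X) : ℝ :=
  g.inner x (s.bracket i α β x) (s.frame i γ x)

theorem structureFunction_trans (hx : x ∈ s.U i ∩ s.U j) (α β γ : Fin 4) :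
    s.structureFunction j α β γ x =
      (∑ a, rotation (s.trans i j x) a α *
        ∑ c, s.transRotationDeriv i j a x c β * rotation (s.trans i j x) c γ) -
      (∑ a, rotation (s.trans i j x) a β *
        ∑ c, s.transRotationDeriv i j a x c α * rotation (s.trans i j x) c γ) +
      ∑ a, ∑ b, ∑ c, rotation (s.trans i j x) a α * rotation (s.trans i j x) b β *
        rotation (s.trans i j x) c γ * s.structureFunction i a b c x := by
  have h : ∀ c, g.inner x (s.bracket j α β x) (s.frame i c x) =
      (∑ a, rotation (s.trans i j x) a α * s.transRotationDeriv i j a x c β) -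
      (∑ a, rotation (s.trans i j x) a β * s.transRotationDeriv i j a x c α) +
      ∑ a, ∑ b, rotation (s.trans i j x) a α * rotation (s.trans i j x) b β *
        s.structureFunction i a b c x := fun c => by
    rw [s.bracket_trans hx, map_add, map_sub, add_apply,
      sub_apply, s.inner_sum_smul_frame hx.1, s.inner_sum_smul_frame hx.1]
    simp only [map_sum, sum_apply, map_smul, smul_apply,
      smul_eq_mul]
    rfl
  rw [structureFunction, s.frame_trans i j x hx]
  simp only [map_sum, map_smul, smul_eq_mul, h, mul_add, mul_sub, Finset.sum_add_distrib,
    Finset.sum_sub_distrib, Finset.mul_sum]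
  congr 1
  · congr 1 <;>
    · rw [Finset.sum_comm]
      exact Finset.sum_congr rfl fun a _ => Finset.sum_congr rfl fun c _ => by ring
  · rw [Finset.sum_comm]
    refine Finset.sum_congr rfl fun a _ => ?_
    rw [Finset.sum_comm]
    exact Finset.sum_congr rfl fun b _ => Finset.sum_congr rfl fun c _ => by ring

variable (i j) in
/-- The components `g(∇_{e_a} e'_β, e_c)`, where `e'` is the `j`-th frame and `e` the `i`-th. -/
def mixedConnection (x : X) (a c β : Fin 4) : ℝ :=
  s.transRotationDeriv i j a x c β +
    ∑ b, rotation (s.trans i j x) b β * s.leviCivita i a b c x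

/-- The Koszul formula collects six inhomogeneous terms, each antisymmetric in its last two indices.
Four cancel in pairs, and the other two add up to twice the expected one. -/
theorem leviCivita_trans (hx : x ∈ s.U i ∩ s.U j) (α β γ : Fin 4) :
    s.leviCivita j α β γ x = ∑ a, rotation (s.trans i j x) a α *
      ∑ c, s.mixedConnection i j x a c β * rotation (s.trans i j x) c γ := by
  have h : ∀ (i : s.ι) (α β γ : Fin 4), s.leviCivita i α β γ x = (1 / 2) *
      (s.structureFunction i α β γ x - s.structureFunction i β γ α x +
        s.structureFunction i γ α β x) := fun _ _ _ _ => rfl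
  set R := rotation (s.trans i j x) with hR
  set C := fun a b c => s.structureFunction i a b c x with hC
  -- This is the form `RᵀdR` evaluated on the new frame, the inhomogeneous part of the structure
  -- functions before antisymmetrisation in the first two indices.
  set D : Fin 4 → Fin 4 → Fin 4 → ℝ := fun α β γ =>
    ∑ a, R a α * ∑ c, s.transRotationDeriv i j a x c β * R c γ with hD
  have hDanti : ∀ α β γ, D α γ β = -D α β γ := fun α β γ => by
    simp only [hD]
    rw [← Finset.sum_neg_distrib]
    exact Finset.sum_congr rfl fun a _ => by
      rw [s.sum_transRotationDeriv_antisymm hx a γ β, mul_neg]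
  have hbca : ∑ a, ∑ b, ∑ c, R a β * R b γ * R c α * C a b c =
      ∑ a, ∑ b, ∑ c, R a α * R b β * R c γ * C b c a := by
    rw [Finset.sum_congr rfl fun a _ => Finset.sum_comm, Finset.sum_comm]
    exact Finset.sum_congr rfl fun a _ => Finset.sum_congr rfl fun b _ =>
      Finset.sum_congr rfl fun c _ => by ring
  have hcab : ∑ a, ∑ b, ∑ c, R a γ * R b α * R c β * C a b c =
      ∑ a, ∑ b, ∑ c, R a α * R b β * R c γ * C c a b := by
    rw [Finset.sum_comm, Finset.sum_congr rfl fun a _ => Finset.sum_comm]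
    exact Finset.sum_congr rfl fun a _ => Finset.sum_congr rfl fun b _ =>
      Finset.sum_congr rfl fun c _ => by ring
  have hrhs : ∑ a, R a α * ∑ c, s.mixedConnection i j x a c β * R c γ =
      D α β γ + ∑ a, ∑ b, ∑ c, R a α * R b β * R c γ * s.leviCivita i a b c x := by
    simp only [mixedConnection, hD, add_mul, Finset.sum_add_distrib, mul_add, Finset.sum_mul,
      Finset.mul_sum]
    congr 1
    refine Finset.sum_congr rfl fun a _ => ?_
    rw [Finset.sum_comm]
    exact Finset.sum_congr rfl fun b _ => Finset.sum_congr rfl fun c _ => by ring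
  rw [hrhs, h, s.structureFunction_trans hx, s.structureFunction_trans hx,
    s.structureFunction_trans hx]
  change (1 / 2) * (D α β γ - D β α γ + ∑ a, ∑ b, ∑ c, R a α * R b β * R c γ * C a b c -
    (D β γ α - D γ β α + ∑ a, ∑ b, ∑ c, R a β * R b γ * R c α * C a b c) +
    (D γ α β - D α γ β + ∑ a, ∑ b, ∑ c, R a γ * R b α * R c β * C a b c)) = _
  have hG : ∑ a, ∑ b, ∑ c, R a α * R b β * R c γ * s.leviCivita i a b c x =
      (1 / 2) * (∑ a, ∑ b, ∑ c, R a α * R b β * R c γ * C a b c -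
        ∑ a, ∑ b, ∑ c, R a α * R b β * R c γ * C b c a +
        ∑ a, ∑ b, ∑ c, R a α * R b β * R c γ * C c a b) := by
    simp only [← Finset.sum_sub_distrib, ← Finset.sum_add_distrib, Finset.mul_sum]
    exact Finset.sum_congr rfl fun a _ => Finset.sum_congr rfl fun b _ =>
      Finset.sum_congr rfl fun c _ => by
        rw [h]
        simp only [hC]
        ring
  rw [hbca, hcab, hG, hDanti α β γ, hDanti β α γ, hDanti γ α β]
  ring

end Transition

end SpinStructure

/-! ### Covariance of the differential operators -/

theorem spinConnection_sum_smul (c : Fin 4 → ℝ) (Γ : Fin 4 → Fin 4 → Fin 4 → ℝ) :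
    spinConnection (fun β γ => ∑ a, c a * Γ a β γ) = ∑ a, c a • spinConnection (Γ a) := by
  simp only [spinConnection, Finset.sum_smul, Finset.smul_sum, mul_smul]
  rw [Finset.sum_congr rfl fun β _ => Finset.sum_comm, Finset.sum_comm]
  simp only [smul_comm (c _) (1 / 4 : ℝ)]

/-- Orthogonality contracts the rotation of the output index with the one hidden in the connection
coefficients. -/
theorem sum_rotation_smul_mul_sum (t : Spin4) (q : ℍ[ℝ]) (K : Fin 4 → Fin 4 → ℝ)
    (φ : Fin 4 → ℍ[ℝ]) (δ : Fin 4) :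
    ∑ β, rotation t δ β • (q * ∑ b, (∑ c, K c b * rotation t c β) • φ b) =
      ∑ b, K δ b • (q * φ b) := by
  rw [← sum_rotation_smul_sum_rotation_smul t (fun c => ∑ b, K c b • (q * φ b)) δ]
  refine Finset.sum_congr rfl fun β _ => ?_
  congr 1
  simp only [Finset.mul_sum, Finset.sum_smul, mul_smul_comm, Finset.smul_sum, smul_smul]
  rw [Finset.sum_comm]
  exact Finset.sum_congr rfl fun c _ => Finset.sum_congr rfl fun b _ => by rw [mul_comm]

namespace SpinStructure

open VectorField Topology

variable {X : Type u} [TopologicalSpace X] [ChartedSpace (EuclideanSpace ℝ (Fin 4)) X]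
  [IsManifold (𝓡 4) ∞ X] {g : RiemMetric X} (s : SpinStructure.{u, v} g)

theorem covDeriv_apply (i : s.ι) (α : Fin 4) (ψ : X → Fin 4 → ℍ[ℝ]) (x : X) (δ : Fin 4) :
    s.covDeriv i α ψ x δ = s.frameDeriv i α (fun y => ψ y δ) x
      + ∑ β, s.leviCivita i α β δ x • ψ x β
      + spinConnection (fun β γ => s.leviCivita i α β γ x) * ψ x δ := by
  simp only [covDeriv, spinConnection, smul_mul_assoc, Finset.sum_mul]

variable {i j : s.ι} {x : X}

/-- The gauge transformation law `ω' = p̄₊ dp₊ + p̄₊ ω p₊`, evaluated on a vector of the new frame.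
-/
theorem spinConnection_trans (hx : x ∈ s.U i ∩ s.U j) (α : Fin 4) :
    spinConnection (fun β γ => s.leviCivita j α β γ x) =
      ∑ a, rotation (s.trans i j x) a α •
        (star ((s.trans i j x).2 : ℍ[ℝ]) * (s.transSndDeriv i j a x +
          spinConnection (fun β γ => s.leviCivita i a β γ x) * ((s.trans i j x).2 : ℍ[ℝ]))) := by
  have h : ∀ a, (fun β γ => ∑ c, s.mixedConnection i j x a c β * rotation (s.trans i j x) c γ) =
      fun β γ => ∑ c, s.transRotationDeriv i j a x c β * rotation (s.trans i j x) c γ +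
        ∑ b, ∑ c, rotation (s.trans i j x) b β * rotation (s.trans i j x) c γ *
          s.leviCivita i a b c x := fun a => by
    funext β γ
    simp only [mixedConnection, add_mul, Finset.sum_add_distrib, Finset.sum_mul]
    congr 1
    rw [Finset.sum_comm]
    exact Finset.sum_congr rfl fun b _ => Finset.sum_congr rfl fun c _ => by ring
  simp only [s.leviCivita_trans hx]
  rw [spinConnection_sum_smul]
  refine Finset.sum_congr rfl fun a _ => ?_
  rw [h, spinConnection_add, spinConnection_rotation, transRotationDeriv,
    spinConnection_rotationDeriv _ (s.star_mul_transFstDeriv hx a)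
      (s.star_mul_transSndDeriv hx a), mul_add, mul_assoc]

theorem frameDeriv_spinAct (hx : x ∈ s.U i ∩ s.U j) {ψ ψ' : X → Fin 4 → ℍ[ℝ]}
    (hψ : ∀ y ∈ s.U i ∩ s.U j, ψ y = spinAct .pos (s.trans i j y) (ψ' y))
    (hd : ∀ β, MDifferentiableAt (𝓡 4) 𝓘(ℝ, ℍ[ℝ]) (fun y => ψ' y β) x) (a δ : Fin 4) :
    s.frameDeriv i a (fun y => ψ y δ) x =
      ∑ β, (s.transRotationDeriv i j a x δ β • (((s.trans i j x).2 : ℍ[ℝ]) * ψ' x β) +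
        rotation (s.trans i j x) δ β • (s.transSndDeriv i j a x * ψ' x β +
          ((s.trans i j x).2 : ℍ[ℝ]) * s.frameDeriv i a (fun y => ψ' y β) x)) := by
  have hq := s.mdifferentiableAt_trans_snd hx
  have hR := s.mdifferentiableAt_rotation hx δ
  have hm := fun β => mdifferentiableAt_quaternion_mul hq (hd β)
  have he : (fun y => ψ y δ) =ᶠ[𝓝 x] fun y => ∑ β, rotation (s.trans i j y) δ β •
      (((s.trans i j y).2 : ℍ[ℝ]) * ψ' y β) :=
    Filter.eventually_of_mem (s.mem_nhds_inter hx) fun y hy => by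
      change ψ y δ = _
      rw [hψ y hy]
      rfl
  refine (dirDeriv_congr (s.frame i a x) he).trans ?_
  refine (dirDeriv_sum (s.frame i a x) Finset.univ fun β => (hR β).smul (hm β)).1.trans ?_
  refine Finset.sum_congr rfl fun β _ => ?_
  refine (dirDeriv_smul (s.frame i a x) (hR β) (hm β)).trans ?_
  rw [s.dirDeriv_frame_rotation hx, dirDeriv_mul _ hq (hd β)]
  rfl

/-- The product rule for `ψ = R p₊ ψ'` gives terms in `dR` and `dp₊`. The first are matched by the
mixed Levi-Civita coefficients, the second by the gauge law of the spin connection. -/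
theorem covDeriv_trans (hx : x ∈ s.U i ∩ s.U j) {ψ ψ' : X → Fin 4 → ℍ[ℝ]}
    (hψ : ∀ y ∈ s.U i ∩ s.U j, ψ y = spinAct .pos (s.trans i j y) (ψ' y))
    (hd : ∀ β, MDifferentiableAt (𝓡 4) 𝓘(ℝ, ℍ[ℝ]) (fun y => ψ' y β) x) (α δ : Fin 4) :
    spinAct .pos (s.trans i j x) (s.covDeriv j α ψ' x) δ =
      ∑ a, rotation (s.trans i j x) a α • s.covDeriv i a ψ x δ := by
  set t := s.trans i j x with ht
  set A := fun a => spinConnection (fun β γ => s.leviCivita i a β γ x) with hA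
  have h1 : ∀ β, s.covDeriv j α ψ' x β = ∑ a, rotation t a α •
      (s.frameDeriv i a (fun y => ψ' y β) x +
        ∑ b, (∑ c, s.mixedConnection i j x a c b * rotation t c β) • ψ' x b +
        star (t.2 : ℍ[ℝ]) * (s.transSndDeriv i j a x + A a * (t.2 : ℍ[ℝ])) * ψ' x β) := fun β => by
    rw [covDeriv_apply, s.frameDeriv_trans hx, s.spinConnection_trans hx]
    simp only [s.leviCivita_trans hx, smul_add, Finset.sum_add_distrib, Finset.sum_mul,
      smul_mul_assoc, Finset.sum_smul]
    congr 2
    rw [Finset.sum_comm]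
    simp only [Finset.smul_sum, mul_smul, Finset.sum_smul]
    rfl
  -- After the factor `R_{aα}` of the direction is removed, the identity can be checked for one
  -- vector of the old frame at a time.
  have h2 : ∀ a, ∑ β, rotation t δ β • ((t.2 : ℍ[ℝ]) * (s.frameDeriv i a (fun y => ψ' y β) x +
        ∑ b, (∑ c, s.mixedConnection i j x a c b * rotation t c β) • ψ' x b +
        star (t.2 : ℍ[ℝ]) * (s.transSndDeriv i j a x + A a * (t.2 : ℍ[ℝ])) * ψ' x β)) =
      s.covDeriv i a ψ x δ := fun a => by
    have hq : ∀ β, (t.2 : ℍ[ℝ]) *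
        (star (t.2 : ℍ[ℝ]) * (s.transSndDeriv i j a x + A a * (t.2 : ℍ[ℝ])) * ψ' x β) =
        s.transSndDeriv i j a x * ψ' x β + A a * ((t.2 : ℍ[ℝ]) * ψ' x β) := fun β => by
      rw [← mul_assoc, ← mul_assoc, t.snd_mul_star, one_mul, add_mul, mul_assoc]
    have hsum : ∑ b, (∑ b', rotation t b' b * s.leviCivita i a b' δ x) •
        ((t.2 : ℍ[ℝ]) * ψ' x b) = ∑ β, s.leviCivita i a β δ x • ψ x β := by
      simp only [hψ x hx, spinAct, chiralPart, Finset.sum_smul, Finset.smul_sum, smul_smul]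
      rw [Finset.sum_comm]
      exact Finset.sum_congr rfl fun b _ => Finset.sum_congr rfl fun c _ => by rw [mul_comm]
    rw [covDeriv_apply, s.frameDeriv_spinAct hx hψ hd]
    simp only [mul_add (t.2 : ℍ[ℝ]), smul_add, Finset.sum_add_distrib, hq]
    rw [sum_rotation_smul_mul_sum, ← hsum]
    simp only [mixedConnection, add_smul, Finset.sum_add_distrib]
    have hψδ : ψ x δ = ∑ β, rotation t δ β • ((t.2 : ℍ[ℝ]) * ψ' x β) := by
      rw [hψ x hx]
      rfl
    rw [hψδ, Finset.mul_sum]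
    simp only [mul_smul_comm, ← ht, hA]
    abel
  simp only [spinAct, chiralPart, h1]
  simp only [← h2, Finset.mul_sum, Finset.smul_sum, mul_smul_comm]
  rw [Finset.sum_comm]
  exact Finset.sum_congr rfl fun a _ => Finset.sum_congr rfl fun β _ => smul_comm _ _ _

/-- Covariance of `∇` contracted with Clifford multiplication: the rotation of the direction is
absorbed by `∑ R_{aα} p₋ e_α p̄₊ = e_a`. -/
theorem dirac_trans (hx : x ∈ s.U i ∩ s.U j) {ψ ψ' : X → Fin 4 → ℍ[ℝ]}
    (hψ : ∀ y ∈ s.U i ∩ s.U j, ψ y = spinAct .pos (s.trans i j y) (ψ' y))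
    (hd : ∀ β, MDifferentiableAt (𝓡 4) 𝓘(ℝ, ℍ[ℝ]) (fun y => ψ' y β) x) :
    s.dirac i ψ x = spinAct .neg (s.trans i j x) (s.dirac j ψ' x) := by
  funext δ
  set t := s.trans i j x with ht
  have h : ∀ α, ∑ β, rotation t δ β • ((t.1 : ℍ[ℝ]) * (clifford .pos α * s.covDeriv j α ψ' x β)) =
      ∑ a, rotation t a α • ((t.1 : ℍ[ℝ]) * clifford .pos α * star (t.2 : ℍ[ℝ]) *
        s.covDeriv i a ψ x δ) := fun α => by
    have := s.covDeriv_trans hx hψ hd α δ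
    simp only [spinAct, chiralPart] at this
    simp only [← mul_smul_comm, ← Finset.mul_sum]
    rw [← this]
    simp only [← mul_smul_comm, ← Finset.mul_sum]
    rw [← mul_assoc, mul_assoc _ (star _), ← mul_assoc (star _), t.star_snd_mul, one_mul]
  have h' : ∀ a, ∑ α, rotation t a α • ((t.1 : ℍ[ℝ]) * clifford .pos α * star (t.2 : ℍ[ℝ])) =
      clifford .pos a := fun a => by
    have e := congrArg (· * star (t.2 : ℍ[ℝ])) (rotation_smul_clifford_pos t a)
    simp only [Finset.sum_mul, smul_mul_assoc] at e
    rw [e, mul_assoc, t.snd_mul_star, mul_one]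
  simp only [spinAct, chiralPart, dirac, Finset.mul_sum, Finset.smul_sum]
  rw [Finset.sum_comm, Finset.sum_congr rfl fun α _ => h α, Finset.sum_comm]
  refine Finset.sum_congr rfl fun a _ => ?_
  rw [← h' a, Finset.sum_mul]
  exact Finset.sum_congr rfl fun α _ => smul_mul_assoc _ _ _

/-! ### The codifferential and the exterior derivative in two frames. -/

section OneForm

variable (a : (x : X) → TangentSpace (𝓡 4) x →L[ℝ] ℂ)

theorem components_trans (hx : x ∈ s.U i ∩ s.U j) (β : Fin 4) :
    s.components j a x β = ∑ c, rotation (s.trans i j x) c β • s.components i a x c := by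
  simp only [components]
  rw [s.frame_trans i j x hx, map_sum]
  exact Finset.sum_congr rfl fun c _ => map_smul _ _ _

variable {a}

theorem frameDeriv_components (hx : x ∈ s.U i ∩ s.U j)
    (ha : ∀ c, MDifferentiableAt (𝓡 4) 𝓘(ℝ, ℂ) (fun y => s.components i a y c) x) (α β : Fin 4) :
    s.frameDeriv j α (fun y => s.components j a y β) x =
      ∑ b, rotation (s.trans i j x) b α • ∑ c,
        (s.transRotationDeriv i j b x c β • s.components i a x c +
          rotation (s.trans i j x) c β • s.frameDeriv i b (fun y => s.components i a y c) x) := by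
  rw [s.frameDeriv_trans hx]
  refine Finset.sum_congr rfl fun b _ => ?_
  congr 1
  have hR := fun c => s.mdifferentiableAt_rotation hx c β
  have he : (fun y => s.components j a y β) =ᶠ[𝓝 x]
      fun y => ∑ c, rotation (s.trans i j y) c β • s.components i a y c :=
    Filter.eventually_of_mem (s.mem_nhds_inter hx) fun y hy => s.components_trans a hy β
  refine (dirDeriv_congr (s.frame i b x) he).trans ?_
  refine (dirDeriv_sum (s.frame i b x) Finset.univ fun c => (hR c).smul (ha c)).1.trans ?_
  refine Finset.sum_congr rfl fun c _ => ?_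
  refine (dirDeriv_smul (s.frame i b x) (hR c) (ha c)).trans ?_
  rw [s.dirDeriv_frame_rotation hx]
  rfl

/-- The derivatives of `R` from the components cancel those in the connection coefficients, so `∇a`
is a tensor; its trace is unchanged by an orthogonal change of frame. -/
theorem codiff_trans (hx : x ∈ s.U i ∩ s.U j)
    (ha : ∀ c, MDifferentiableAt (𝓡 4) 𝓘(ℝ, ℂ) (fun y => s.components i a y c) x) :
    s.codiff j a x = s.codiff i a x := by
  set R := rotation (s.trans i j x) with hR
  set A := s.components i a x with hA
  -- Inverting the rotation of the components lets the last index of the connection be contracted,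
  -- leaving the mixed coefficients.
  have hinv : ∀ c, ∑ γ, R c γ • s.components j a x γ = A c := fun c => by
    simp only [s.components_trans a hx]
    exact sum_rotation_smul_sum_rotation_smul (s.trans i j x) A c
  have hΓ : ∀ α, ∑ γ, (s.leviCivita j α α γ x : ℂ) * s.components j a x γ =
      ∑ b, R b α • ∑ c, s.mixedConnection i j x b c α • A c := fun α => by
    simp only [← hinv, s.leviCivita_trans hx, ← Complex.real_smul, Finset.sum_smul, Finset.smul_sum,
      smul_smul, Finset.mul_sum]
    rw [Finset.sum_comm]
    refine Finset.sum_congr rfl fun b _ => ?_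
    rw [Finset.sum_comm]
  have hD : ∀ α, s.frameDeriv j α (fun y => s.components j a y α) x -
      ∑ γ, (s.leviCivita j α α γ x : ℂ) * s.components j a x γ =
      ∑ b, R b α • ∑ c, R c α • (s.frameDeriv i b (fun y => s.components i a y c) x -
        ∑ γ, (s.leviCivita i b c γ x : ℂ) * A γ) := fun α => by
    rw [hΓ, s.frameDeriv_components hx ha, ← Finset.sum_sub_distrib]
    refine Finset.sum_congr rfl fun b _ => ?_
    rw [← smul_sub]
    congr 1
    simp only [mixedConnection, add_smul, Finset.sum_add_distrib, smul_sub, Finset.sum_sub_distrib,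
      Finset.sum_smul, Finset.smul_sum, mul_smul, Complex.real_smul]
    rw [Finset.sum_comm (f := fun c b' => (R b' α : ℂ) * ((s.leviCivita i b b' c x : ℂ) * A c))]
    ring
  simp only [codiff, hD]
  congr 1
  rw [Finset.sum_comm]
  exact Finset.sum_congr rfl fun b _ => sum_rotation_smul_sum_rotation_smul (s.trans i j x)
    (fun c => s.frameDeriv i b (fun y => s.components i a y c) x -
        ∑ γ, (s.leviCivita i b c γ x : ℂ) * A γ) b

/-- The two sums containing `dR` from differentiating the components are exactly those contributed
by the bracket of the rotated frame. -/
theorem extDerivComponents_trans (hx : x ∈ s.U i ∩ s.U j)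
    (ha : ∀ c, MDifferentiableAt (𝓡 4) 𝓘(ℝ, ℂ) (fun y => s.components i a y c) x) (α β : Fin 4) :
    s.extDerivComponents j a x α β = ∑ b, ∑ c,
      (rotation (s.trans i j x) b α * rotation (s.trans i j x) c β) •
        s.extDerivComponents i a x b c := by
  set R := rotation (s.trans i j x) with hR
  set A := s.components i a x with hA
  set dA := fun b c => s.frameDeriv i b (fun y => s.components i a y c) x with hdA
  have hbr : a x (s.bracket j α β x) =
      ∑ b, R b α • ∑ c, s.transRotationDeriv i j b x c β • A c -
      ∑ b, R b β • ∑ c, s.transRotationDeriv i j b x c α • A c +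
      ∑ b, ∑ c, (R b α * R c β) • a x (s.bracket i b c x) := by
    rw [s.bracket_trans hx, map_add, map_sub]
    simp only [map_sum, map_smul, Finset.sum_smul, Finset.smul_sum, smul_smul]
    congr 1
    congr 1 <;>
    · rw [Finset.sum_comm]
      rfl
  have hswap : ∑ b, R b β • ∑ c, R c α • dA b c = ∑ b, ∑ c, (R b α * R c β) • dA c b := by
    simp only [Finset.smul_sum, smul_smul]
    rw [Finset.sum_comm]
    exact Finset.sum_congr rfl fun b _ => Finset.sum_congr rfl fun c _ => by rw [mul_comm]
  have hE : ∀ b c, s.extDerivComponents i a x b c = dA b c - dA c b - a x (s.bracket i b c x) :=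
    fun _ _ => rfl
  rw [extDerivComponents, s.frameDeriv_components hx ha, s.frameDeriv_components hx ha, hbr]
  simp only [hE, smul_sub, Finset.sum_sub_distrib, ← hswap]
  simp only [smul_add, Finset.sum_add_distrib, Finset.smul_sum, smul_smul]
  ring

end OneForm

end SpinStructure

/-! ### Smoothness -/

theorem contDiff_quatColumn (r : Fin 2) : ContDiff ℝ ∞ (fun q : ℍ[ℝ] => quatColumn q r) :=
  (LinearMap.toContinuousLinearMap
    ((Matrix.entryLinearMap ℝ ℂ r 0).comp quatMatrixLinear)).contDiff

theorem contDiff_mu (r k : Fin 2) : ContDiff ℝ ∞ (fun ψ : Fin 4 → ℍ[ℝ] => mu ψ r k) := by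
  have hc : ∀ (α : Fin 4) (r : Fin 2),
      ContDiff ℝ ∞ (fun ψ : Fin 4 → ℍ[ℝ] => quatColumn (ψ α) r) := fun α r =>
    (contDiff_quatColumn r).comp (contDiff_apply ℝ ℍ[ℝ] α)
  have hs : ∀ (α : Fin 4) (r : Fin 2),
      ContDiff ℝ ∞ (fun ψ : Fin 4 → ℍ[ℝ] => star (quatColumn (ψ α) r)) := fun α r =>
    (Complex.conjCLE : ℂ ≃L[ℝ] ℂ).contDiff.comp (hc α r)
  have hT : ∀ r k : Fin 2, ContDiff ℝ ∞ (fun ψ : Fin 4 → ℍ[ℝ] =>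
      ∑ α, quatColumn (ψ α) r * star (quatColumn (ψ α) k)) := fun r k =>
    ContDiff.sum fun α _ => (hc α r).mul (hs α k)
  have h : ∀ ψ : Fin 4 → ℍ[ℝ], mu ψ r k =
      ∑ α, quatColumn (ψ α) r * star (quatColumn (ψ α) k) -
        (1 / 2 : ℂ) * (∑ l, ∑ α, quatColumn (ψ α) l * star (quatColumn (ψ α) l)) *
          (1 : Matrix (Fin 2) (Fin 2) ℂ) r k := fun ψ => by
    simp only [mu, Matrix.sub_apply, Matrix.smul_apply, Matrix.sum_apply, Matrix.vecMulVec_apply,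
      Pi.star_apply, smul_eq_mul, Matrix.trace, Matrix.diag_apply]
  simp only [h]
  exact (hT r k).sub ((contDiff_const.mul (ContDiff.sum fun l _ => hT l l)).mul contDiff_const)

/-- Each component is a real quadratic polynomial in the spinor. -/
theorem contDiff_rhoInv_mu (α β : Fin 4) :
    ContDiff ℝ ∞ (fun ψ : Fin 4 → ℍ[ℝ] => rhoInv (mu ψ) α β) := by
  simp only [rhoInv_apply (mu_trace _), Matrix.trace, Matrix.diag_apply, Matrix.mul_apply]
  exact contDiff_const.mul (ContDiff.sum fun r _ => ContDiff.sum fun k _ =>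
    (contDiff_mu r k).mul contDiff_const)

/-- The inclusion `ℂ → ℍ` as a real continuous linear map. -/
def complexQuaternionL : ℂ →L[ℝ] ℍ[ℝ] :=
  LinearMap.toContinuousLinearMap
    { toFun := fun z => (z : ℍ[ℝ])
      map_add' := fun z w => by ext <;> simp
      map_smul' := fun c z => by ext <;> simp }

namespace SpinStructure

open VectorField Topology

variable {X : Type u} [TopologicalSpace X] [ChartedSpace (EuclideanSpace ℝ (Fin 4)) X]

section

variable {F G H : Type*} [NormedAddCommGroup F] [NormedSpace ℝ F] [NormedAddCommGroup G]
  [NormedSpace ℝ G] [NormedAddCommGroup H] [NormedSpace ℝ H] {U : Set X}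

theorem contMDiffOn_clm (L : F →L[ℝ] G) {f : X → F} (hf : ContMDiffOn (𝓡 4) 𝓘(ℝ, F) ∞ f U) :
    ContMDiffOn (𝓡 4) 𝓘(ℝ, G) ∞ (fun y => L (f y)) U :=
  L.contMDiff.comp_contMDiffOn hf

theorem contMDiffOn_bilin (B : F →L[ℝ] G →L[ℝ] H) {f : X → F} {k : X → G}
    (hf : ContMDiffOn (𝓡 4) 𝓘(ℝ, F) ∞ f U) (hk : ContMDiffOn (𝓡 4) 𝓘(ℝ, G) ∞ k U) :
    ContMDiffOn (𝓡 4) 𝓘(ℝ, H) ∞ (fun y => B (f y) (k y)) U :=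
  (contMDiffOn_clm B hf).clm_apply hk

theorem contMDiffOn_const_mul (q : ℍ[ℝ]) {f : X → ℍ[ℝ]}
    (hf : ContMDiffOn (𝓡 4) 𝓘(ℝ, ℍ[ℝ]) ∞ f U) :
    ContMDiffOn (𝓡 4) 𝓘(ℝ, ℍ[ℝ]) ∞ (fun y => q * f y) U :=
  contMDiffOn_clm (ContinuousLinearMap.mul ℝ ℍ[ℝ] q) hf

theorem contMDiffOn_const_smul (c : ℝ) {f : X → F} (hf : ContMDiffOn (𝓡 4) 𝓘(ℝ, F) ∞ f U) :
    ContMDiffOn (𝓡 4) 𝓘(ℝ, F) ∞ (fun y => c • f y) U :=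
  contMDiffOn_clm (ContinuousLinearMap.lsmul ℝ ℝ c) hf

theorem contMDiffOn_sum {f : Fin 4 → X → F} (hf : ∀ α, ContMDiffOn (𝓡 4) 𝓘(ℝ, F) ∞ (f α) U) :
    ContMDiffOn (𝓡 4) 𝓘(ℝ, F) ∞ (fun y => ∑ α, f α y) U := by
  simp only [Fin.sum_univ_four]
  exact (((hf 0).add (hf 1)).add (hf 2)).add (hf 3)

theorem contMDiffOn_projNeg {φ : X → Fin 4 → ℍ[ℝ]}
    (hφ : ContMDiffOn (𝓡 4) 𝓘(ℝ, Fin 4 → ℍ[ℝ]) ∞ φ U) :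
    ContMDiffOn (𝓡 4) 𝓘(ℝ, Fin 4 → ℍ[ℝ]) ∞ (fun y => projNeg (φ y)) U := by
  rw [contMDiffOn_pi_space] at hφ ⊢
  exact fun α => (hφ α).add (contMDiffOn_const_smul _ (contMDiffOn_const_mul _
    (contMDiffOn_sum fun β => contMDiffOn_const_mul _ (hφ β))))

theorem contMDiffOn_covectorMul {a : X → Fin 4 → ℂ} {ψ : X → Fin 4 → ℍ[ℝ]}
    (ha : ∀ α, ContMDiffOn (𝓡 4) 𝓘(ℝ, ℂ) ∞ (fun y => a y α) U)
    (hψ : ContMDiffOn (𝓡 4) 𝓘(ℝ, Fin 4 → ℍ[ℝ]) ∞ ψ U) :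
    ContMDiffOn (𝓡 4) 𝓘(ℝ, Fin 4 → ℍ[ℝ]) ∞ (fun y => covectorMul (a y) (ψ y)) U := by
  rw [contMDiffOn_pi_space] at hψ ⊢
  exact fun δ => contMDiffOn_sum fun α => contMDiffOn_bilin (ContinuousLinearMap.mul ℝ ℍ[ℝ])
    (contMDiffOn_const_mul _ (hψ δ)) (contMDiffOn_clm complexQuaternionL (ha α))

theorem contMDiffOn_selfDualPart {η : X → Fin 4 → Fin 4 → ℂ}
    (hη : ∀ α β, ContMDiffOn (𝓡 4) 𝓘(ℝ, ℂ) ∞ (fun y => η y α β) U) (α β : Fin 4) :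
    ContMDiffOn (𝓡 4) 𝓘(ℝ, ℂ) ∞ (fun y => selfDualPart (η y) α β) U := by
  have hmul : ∀ (c : ℂ) {f : X → ℂ}, ContMDiffOn (𝓡 4) 𝓘(ℝ, ℂ) ∞ f U →
      ContMDiffOn (𝓡 4) 𝓘(ℝ, ℂ) ∞ (fun y => c * f y) U := fun c _ hf =>
    contMDiffOn_clm (ContinuousLinearMap.mul ℝ ℂ c) hf
  exact hmul _ ((hη α β).add (hmul _ (contMDiffOn_sum fun γ => contMDiffOn_sum fun δ =>
    hmul _ (hη γ δ))))

end

variable [IsManifold (𝓡 4) ∞ X] {g : RiemMetric X} (s : SpinStructure.{u, v} g)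

theorem contMDiffOn_leviCivita (i : s.ι) (α β γ : Fin 4) :
    ContMDiffOn (𝓡 4) 𝓘(ℝ, ℝ) ∞ (s.leviCivita i α β γ) (s.U i) := by
  have h : ∀ α β γ, ContMDiffOn (𝓡 4) 𝓘(ℝ, ℝ) ∞
      (fun x => g.inner x (s.bracket i α β x) (s.frame i γ x)) (s.U i) := fun α β γ =>
    contMDiffOn_metric g (contMDiffOn_mlieBracket (s.isOpen_U i) (s.smooth_frame i α)
      (s.smooth_frame i β)) (s.smooth_frame i γ)
  exact contMDiffOn_const_smul (1 / 2 : ℝ) (((h α β γ).sub (h β γ α)).add (h γ α β))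

theorem contMDiffOn_frameDeriv {F : Type*} [NormedAddCommGroup F] [NormedSpace ℝ F] (i : s.ι)
    (α : Fin 4) {f : X → F} (hf : ContMDiffOn (𝓡 4) 𝓘(ℝ, F) ∞ f (s.U i)) :
    ContMDiffOn (𝓡 4) 𝓘(ℝ, F) ∞ (s.frameDeriv i α f) (s.U i) :=
  contMDiffOn_dirDeriv (s.isOpen_U i) (s.smooth_frame i α) hf

theorem contMDiffOn_dirac (i : s.ι) {ψ : X → Fin 4 → ℍ[ℝ]}
    (hψ : ContMDiffOn (𝓡 4) 𝓘(ℝ, Fin 4 → ℍ[ℝ]) ∞ ψ (s.U i)) :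
    ContMDiffOn (𝓡 4) 𝓘(ℝ, Fin 4 → ℍ[ℝ]) ∞ (s.dirac i ψ) (s.U i) := by
  rw [contMDiffOn_pi_space] at hψ ⊢
  exact fun δ => contMDiffOn_sum fun α => contMDiffOn_const_mul _
    (((s.contMDiffOn_frameDeriv i α (hψ δ)).add
      (contMDiffOn_sum fun β => (s.contMDiffOn_leviCivita i α β δ).smul (hψ β))).add
      (contMDiffOn_const_smul _ (contMDiffOn_sum fun β => contMDiffOn_sum fun γ =>
        (s.contMDiffOn_leviCivita i α β γ).smul (contMDiffOn_const_mul _ (hψ δ)))))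

theorem contMDiffOn_codiff (i : s.ι) (a : s.ImOneForm) :
    ContMDiffOn (𝓡 4) 𝓘(ℝ, ℂ) ∞ (s.codiff i a.toFun) (s.U i) :=
  (contMDiffOn_sum fun α => (s.contMDiffOn_frameDeriv i α (a.smooth i α)).sub
    (contMDiffOn_sum fun γ => (contMDiffOn_bilin (ContinuousLinearMap.lsmul ℝ ℝ)
      (s.contMDiffOn_leviCivita i α α γ) (a.smooth i γ)).congr
        fun y _ => (Complex.real_smul (x := s.leviCivita i α α γ y)).symm)).neg

/-! ### The frame spans the tangent space -/

/-- Four orthonormal vectors are independent, and the tangent space has dimension four. -/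
theorem span_frame {i : s.ι} {x : X} (hx : x ∈ s.U i) :
    Submodule.span ℝ (Set.range fun α => s.frame i α x) = ⊤ := by
  have hli : LinearIndependent ℝ fun α => s.frame i α x := by
    rw [Fintype.linearIndependent_iff]
    intro c hc γ
    have h := s.inner_sum_smul_frame hx c γ
    rw [hc, map_zero] at h
    exact h.symm
  have : FiniteDimensional ℝ (TangentSpace (𝓡 4) x) :=
    inferInstanceAs (FiniteDimensional ℝ (EuclideanSpace ℝ (Fin 4)))
  refine hli.span_eq_top_of_card_eq_finrank' ?_
  exact (Fintype.card_fin 4).trans (finrank_euclideanSpace_fin (𝕜 := ℝ) (n := 4)).symm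

theorem sum_inner_smul_frame {i : s.ι} {x : X} (hx : x ∈ s.U i) (w : TangentSpace (𝓡 4) x) :
    ∑ γ, g.inner x w (s.frame i γ x) • s.frame i γ x = w := by
  have hw : w ∈ Submodule.span ℝ (Set.range fun α => s.frame i α x) := by
    rw [s.span_frame hx]
    trivial
  obtain ⟨c, rfl⟩ := (Submodule.mem_span_range_iff_exists_fun ℝ).1 hw
  simp only [s.inner_sum_smul_frame hx]

/-- A one-form with smooth components in every frame is smooth along smooth vector fields. -/
theorem contMDiffOn_apply (i : s.ι) (a : s.ImOneForm) {V : (x : X) → TangentSpace (𝓡 4) x}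
    (hV : ContMDiffOn (𝓡 4) (𝓡 4).tangent ∞ (fun x => (⟨x, V x⟩ : TangentBundle (𝓡 4) X))
      (s.U i)) :
    ContMDiffOn (𝓡 4) 𝓘(ℝ, ℂ) ∞ (fun x => a.toFun x (V x)) (s.U i) := by
  refine (contMDiffOn_sum fun γ => (contMDiffOn_metric g hV (s.smooth_frame i γ)).smul
    (a.smooth i γ)).congr fun x hx => ?_
  conv_lhs => rw [← s.sum_inner_smul_frame hx (V x), map_sum]
  exact Finset.sum_congr rfl fun γ _ => map_smul _ _ _

/-- The bracket term pairs the form with a field outside the frame, which is why smoothness along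
arbitrary smooth fields is required. -/
theorem contMDiffOn_extDerivComponents (i : s.ι) (a : s.ImOneForm) (α β : Fin 4) :
    ContMDiffOn (𝓡 4) 𝓘(ℝ, ℂ) ∞ (fun x => s.extDerivComponents i a.toFun x α β) (s.U i) :=
  ((s.contMDiffOn_frameDeriv i α (a.smooth i β)).sub
    (s.contMDiffOn_frameDeriv i β (a.smooth i α))).sub
    (s.contMDiffOn_apply i a (contMDiffOn_mlieBracket (s.isOpen_U i) (s.smooth_frame i α)
      (s.smooth_frame i β)))

end SpinStructure

/-! ### Equivariance under `Pin(2)` -/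

namespace SpinStructure

open Topology

variable {X : Type u} [TopologicalSpace X] [ChartedSpace (EuclideanSpace ℝ (Fin 4)) X]
  [IsManifold (𝓡 4) ∞ X] {g : RiemMetric X} (s : SpinStructure.{u, v} g)

section Pin

variable (i : s.ι) {x : X} (p : pin2)

theorem covDeriv_pinAct {ψ : X → Fin 4 → ℍ[ℝ]}
    (hd : ∀ β, MDifferentiableAt (𝓡 4) 𝓘(ℝ, ℍ[ℝ]) (fun y => ψ y β) x) (α : Fin 4) :
    s.covDeriv i α (fun y => pinAct p (ψ y)) x = pinAct p (s.covDeriv i α ψ x) := by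
  funext δ
  have h : s.frameDeriv i α (fun y => pinAct p (ψ y) δ) x =
      s.frameDeriv i α (fun y => ψ y δ) x * ((p⁻¹ : pin2) : ℍ[ℝ]) :=
    dirDeriv_clm (s.frame i α x)
      ((ContinuousLinearMap.mul ℝ ℍ[ℝ]).flip ((p⁻¹ : pin2) : ℍ[ℝ])) (hd δ)
  rw [covDeriv_apply, h]
  simp only [pinAct, covDeriv_apply, add_mul, Finset.sum_mul, smul_mul_assoc, mul_assoc]

theorem raritaSchwinger_pinAct {ψ : X → Fin 4 → ℍ[ℝ]}
    (hd : ∀ β, MDifferentiableAt (𝓡 4) 𝓘(ℝ, ℍ[ℝ]) (fun y => ψ y β) x) :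
    s.raritaSchwinger i (fun y => pinAct p (ψ y)) x = pinAct p (s.raritaSchwinger i ψ x) := by
  rw [raritaSchwinger, raritaSchwinger, ← projNeg_pinAct]
  congr 1
  funext δ
  simp only [dirac, s.covDeriv_pinAct i p hd, pinAct, Finset.sum_mul, mul_assoc]

theorem frameDeriv_smul (r : ℝ) (α : Fin 4) {f : X → ℂ}
    (hf : MDifferentiableAt (𝓡 4) 𝓘(ℝ, ℂ) f x) :
    s.frameDeriv i α (fun y => r • f y) x = r • s.frameDeriv i α f x :=
  dirDeriv_clm (s.frame i α x) (ContinuousLinearMap.lsmul ℝ ℝ r) hf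

variable {a : (x : X) → TangentSpace (𝓡 4) x →L[ℝ] ℂ}

theorem codiff_smul
    (ha : ∀ c, MDifferentiableAt (𝓡 4) 𝓘(ℝ, ℂ) (fun y => s.components i a y c) x)
    (r : ℝ) :
    s.codiff i (fun y => r • a y) x = r • s.codiff i a x := by
  have h : ∀ α y, s.components i (fun y => r • a y) y α = r • s.components i a y α :=
    fun _ _ => rfl
  simp only [codiff, h, s.frameDeriv_smul i r _ (ha _), smul_neg, Finset.smul_sum, smul_sub,
    mul_smul_comm]

theorem extDerivComponents_smul
    (ha : ∀ c, MDifferentiableAt (𝓡 4) 𝓘(ℝ, ℂ) (fun y => s.components i a y c) x)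
    (r : ℝ) :
    s.extDerivComponents i (fun y => r • a y) x =
      fun α β => r • s.extDerivComponents i a x α β := by
  have h : ∀ α y, s.components i (fun y => r • a y) y α = r • s.components i a y α :=
    fun _ _ => rfl
  funext α β
  simp only [extDerivComponents, h, s.frameDeriv_smul i r _ (ha _), smul_sub]
  rfl

end Pin

variable {s}

theorem ThreeHalfSpinor.mdifferentiableAt {c : Chirality} (ψ : s.ThreeHalfSpinor c) {i : s.ι}
    {x : X} (hx : x ∈ s.U i) (β : Fin 4) :
    MDifferentiableAt (𝓡 4) 𝓘(ℝ, ℍ[ℝ]) (fun y => ψ.toFun i y β) x :=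
  ((contMDiffOn_pi_space.1 (ψ.smooth i) β x hx).contMDiffAt
    ((s.isOpen_U i).mem_nhds hx)).mdifferentiableAt (by simp)

theorem ImOneForm.mdifferentiableAt (a : s.ImOneForm) {i : s.ι} {x : X} (hx : x ∈ s.U i)
    (α : Fin 4) :
    MDifferentiableAt (𝓡 4) 𝓘(ℝ, ℂ) (fun y => s.components i a.toFun y α) x :=
  ((a.smooth i α x hx).contMDiffAt ((s.isOpen_U i).mem_nhds hx)).mdifferentiableAt (by simp)

/-! ### The range space in local frames -/

theorem ThreeHalfSpinor.ext_of_mem {c : Chirality} {φ χ : s.ThreeHalfSpinor c}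
    (h : ∀ i, ∀ x ∈ s.U i, φ.toFun i x = χ.toFun i x) : φ = χ := by
  apply ThreeHalfSpinor.ext
  funext i x
  by_cases hx : x ∈ s.U i
  · exact h i x hx
  · rw [φ.eq_zero i x hx, χ.eq_zero i x hx]

/-- A bilinear form is determined by its values on a spanning set, and the frame domains cover `X`.
-/
theorem ImSelfDualForm.ext_of_components {η θ : s.ImSelfDualForm}
    (h : ∀ i, ∀ x ∈ s.U i, s.components₂ i η.toFun x = s.components₂ i θ.toFun x) : η = θ := by
  apply ImSelfDualForm.ext
  funext x
  obtain ⟨i, hx⟩ := s.cover x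
  apply ContinuousLinearMap.coe_injective
  refine LinearMap.ext_on (s.span_frame hx) ?_
  rintro _ ⟨α, rfl⟩
  apply ContinuousLinearMap.coe_injective
  refine LinearMap.ext_on (s.span_frame hx) ?_
  rintro _ ⟨β, rfl⟩
  exact congrFun (congrFun (h i x hx) α) β

theorem Range.ext_of_mem {r r' : s.Range}
    (h : ∀ i, ∀ x ∈ s.U i, r.1.toFun i x = r'.1.toFun i x ∧ r.2.1.toFun x = r'.2.1.toFun x ∧
      s.components₂ i r.2.2.toFun x = s.components₂ i r'.2.2.toFun x) : r = r' := by
  refine Prod.ext (ThreeHalfSpinor.ext_of_mem fun i x hx => (h i x hx).1)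
    (Prod.ext (ImFunction.ext (funext fun x => ?_))
      (ImSelfDualForm.ext_of_components fun i x hx => (h i x hx).2.2))
  obtain ⟨i, hx⟩ := s.cover x
  exact (h i x hx).2.1

/-- The defining condition prescribes every local expression of every value. -/
theorem IsRSSWFunctional.unique {F F' : s.Config → s.Range} (hF : s.IsRSSWFunctional F)
    (hF' : s.IsRSSWFunctional F') : F = F' := by
  funext ⟨ψ, a⟩
  refine Range.ext_of_mem fun i x hx => ?_
  obtain ⟨h1, h2, h3⟩ := hF ψ a i x hx
  obtain ⟨k1, k2, k3⟩ := hF' ψ a i x hx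
  exact ⟨h1.trans k1.symm, h2.trans k2.symm, h3.trans k3.symm⟩

theorem IsRSSWFunctional.map_smul {F : s.Config → s.Range} (hF : s.IsRSSWFunctional F) (p : pin2)
    (c : s.Config) : F (p • c) = p • F c := by
  obtain ⟨ψ, a⟩ := c
  refine Range.ext_of_mem fun i x hx => ?_
  obtain ⟨h1, h2, h3⟩ := hF (p • ψ) (p • a) i x hx
  obtain ⟨k1, k2, k3⟩ := hF ψ a i x hx
  refine ⟨h1.trans ?_, h2.trans ?_, h3.trans ?_⟩
  -- The actions unfold by definition, exposing right multiplication on `ψ` and the sign on the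
  -- components of `a`.
  · change s.raritaSchwinger i (fun y => pinAct p (ψ.toFun i y)) x +
      projNeg (covectorMul (fun α => pinSign p • s.components i a.toFun x α)
        (pinAct p (ψ.toFun i x))) = pinAct p ((F (ψ, a)).1.toFun i x)
    rw [k1, s.raritaSchwinger_pinAct i p (ψ.mdifferentiableAt hx),
      covectorMul_pinAct p (s.components i a.toFun x) (fun α => a.imaginary x _), projNeg_pinAct, pinAct_add]
  · change s.codiff i (fun y => pinSign p • a.toFun y) x = pinSign p • (F (ψ, a)).2.1.toFun x
    rw [k2, s.codiff_smul i (a.mdifferentiableAt hx)]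
  · change selfDualPart (s.extDerivComponents i (fun y => pinSign p • a.toFun y) x) -
      rhoInv (mu (pinAct p (ψ.toFun i x))) =
        fun α β => pinSign p • s.components₂ i (F (ψ, a)).2.2.toFun x α β
    rw [k3, s.extDerivComponents_smul i (a.mdifferentiableAt hx), selfDualPart_smul, mu_pinAct,
      rhoInv_smul]
    funext α β
    exact (smul_sub _ _ _).symm

/-! ### Construction of the functional -/

variable (s)

/-- The `𝔰⁻_{3/2}`-component `Q⁺ψ + π⁻(a · ψ)` of the functional in a local frame. -/
def spinorComponent (ψ : s.ThreeHalfSpinor .pos) (a : s.ImOneForm) (i : s.ι) (x : X) :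
    Fin 4 → ℍ[ℝ] :=
  s.raritaSchwinger i (ψ.toFun i) x +
    projNeg (covectorMul (s.components i a.toFun x) (ψ.toFun i x))

/-- The `iΛ⁺`-component `d⁺a - ρ⁻¹(μ(ψ))` of the functional in a local frame. -/
def curvatureComponent (ψ : s.ThreeHalfSpinor .pos) (a : s.ImOneForm) (i : s.ι) (x : X) :
    Fin 4 → Fin 4 → ℂ :=
  selfDualPart (s.extDerivComponents i a.toFun x) - rhoInv (mu (ψ.toFun i x))

variable {s} (ψ : s.ThreeHalfSpinor .pos) (a : s.ImOneForm)

/-! ### Covariance and reality of the local expressions. -/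

theorem spinorComponent_trans {i j : s.ι} {x : X} (hx : x ∈ s.U i ∩ s.U j) :
    s.spinorComponent ψ a i x = spinAct .neg (s.trans i j x) (s.spinorComponent ψ a j x) := by
  rw [spinorComponent, spinorComponent, spinAct_add, raritaSchwinger, raritaSchwinger,
    s.dirac_trans hx (ψ.compat i j) (ψ.mdifferentiableAt hx.2), projNeg_spinAct, ψ.compat i j x hx,
    covectorMul_spinAct _ _ _ _ (s.components_trans a.toFun hx), projNeg_spinAct]

theorem extDerivComponents_antisymm (i : s.ι) (x : X) (α β : Fin 4) :
    s.extDerivComponents i a.toFun x β α = -s.extDerivComponents i a.toFun x α β := by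
  have h : s.bracket i β α x = -s.bracket i α β x := VectorField.mlieBracket_swap_apply
  simp only [extDerivComponents, h, map_neg]
  ring

/-- Taking real parts is linear, so it commutes with differentiation, and the real part of `a`
vanishes identically. -/
theorem frameDeriv_re {i : s.ι} {x : X} (hx : x ∈ s.U i) (α β : Fin 4) :
    (s.frameDeriv i α (fun y => s.components i a.toFun y β) x).re = 0 := by
  have h := dirDeriv_clm (s.frame i α x) Complex.reCLM (a.mdifferentiableAt hx β)
  have h0 : (fun y => Complex.reCLM (s.components i a.toFun y β)) = fun _ : X => (0 : ℝ) := by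
    funext y
    exact a.imaginary y _
  rw [h0, dirDeriv_const] at h
  exact h.symm

theorem extDerivComponents_re {i : s.ι} {x : X} (hx : x ∈ s.U i) (α β : Fin 4) :
    (s.extDerivComponents i a.toFun x α β).re = 0 := by
  simp only [extDerivComponents, Complex.sub_re, frameDeriv_re a hx, a.imaginary, sub_zero]

theorem codiff_re {i : s.ι} {x : X} (hx : x ∈ s.U i) : (s.codiff i a.toFun x).re = 0 := by
  have h : ∀ γ, (s.components i a.toFun x γ).re = 0 := fun γ => a.imaginary x _
  simp only [codiff, Complex.neg_re, Complex.re_sum, Complex.sub_re, frameDeriv_re a hx,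
    Complex.re_ofReal_mul, h, mul_zero, Finset.sum_const_zero, sub_zero, neg_zero]

theorem isImSelfDual_curvatureComponent {i : s.ι} {x : X} (hx : x ∈ s.U i) :
    IsImSelfDual (s.curvatureComponent ψ a i x) :=
  (isImSelfDual_selfDualPart (extDerivComponents_re a hx) (extDerivComponents_antisymm a i x)).sub
    (isImSelfDual_rhoInv _ (mu_isHermitian _) (mu_trace _))

theorem curvatureComponent_trans {i j : s.ι} {x : X} (hx : x ∈ s.U i ∩ s.U j) (α β : Fin 4) :
    s.curvatureComponent ψ a j x α β = ∑ b, ∑ c,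
      (rotation (s.trans i j x) b α * rotation (s.trans i j x) c β) •
        s.curvatureComponent ψ a i x b c := by
  have hq := quatMatrix_mul_conjTranspose_of_star (s.trans i j x).snd_mul_star
  -- Spinors are related from `j` to `i` but forms from `i` to `j`, so the conjugation law is
  -- inverted here.
  have hmu : mu (ψ.toFun j x) = (quatMatrix (s.trans i j x).2)ᴴ * mu (ψ.toFun i x) *
      quatMatrix (s.trans i j x).2 := by
    rw [ψ.compat i j x hx, mu_spinAct]
    simp only [← mul_assoc]
    rw [mul_eq_one_comm.1 hq, one_mul, mul_assoc, mul_eq_one_comm.1 hq, mul_one]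
  have h1 := selfDualPart_rotation (s.trans i j x) (extDerivComponents_antisymm a i x)
    (s.extDerivComponents_trans hx (a.mdifferentiableAt hx.1)) α β
  have h2 := rhoInv_conj (s.trans i j x) (mu_trace (ψ.toFun i x)) α β
  simp only [curvatureComponent, Pi.sub_apply, smul_sub, Finset.sum_sub_distrib]
  rw [h1, hmu, h2]

/-- The section `Q⁺ψ + π⁻(a · ψ)` of `𝔰⁻_{3/2}`. -/
def spinorSection : s.ThreeHalfSpinor .neg where
  -- Local representatives must vanish off their domain; this is what makes a section determined by
  -- its values on the domains.
  toFun i := (s.U i).indicator (s.spinorComponent ψ a i)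
  eq_zero _ _ hx := Set.indicator_of_notMem hx _
  compat i j x hx := by
    rw [Set.indicator_of_mem hx.1, Set.indicator_of_mem hx.2, spinorComponent_trans ψ a hx]
  smooth i := by
    refine ContMDiffOn.congr ?_ fun x hx => Set.indicator_of_mem hx _
    exact (contMDiffOn_projNeg (s.contMDiffOn_dirac i (ψ.smooth i))).add
      (contMDiffOn_projNeg (contMDiffOn_covectorMul (a.smooth i) (ψ.smooth i)))
  contraction_eq_zero i x hx := by
    rw [Set.indicator_of_mem hx, spinorComponent, raritaSchwinger, ← projNeg_add,
      contraction_projNeg]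

/-- A local frame around a point. -/
def frameAt (s : SpinStructure.{u, v} g) (x : X) : s.ι := (s.cover x).choose

theorem mem_frameAt (s : SpinStructure.{u, v} g) (x : X) : x ∈ s.U (s.frameAt x) :=
  (s.cover x).choose_spec

theorem codiff_frameAt {i : s.ι} {x : X} (hx : x ∈ s.U i) :
    s.codiff (s.frameAt x) a.toFun x = s.codiff i a.toFun x :=
  s.codiff_trans ⟨hx, s.mem_frameAt x⟩ (a.mdifferentiableAt hx)

/-- The function `d*a`. -/
def codiffFunction : ImFunction (X := X) where
  toFun x := s.codiff (s.frameAt x) a.toFun x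
  imaginary x := codiff_re a (s.mem_frameAt x)
  -- The chosen frame may jump from point to point. Near `x` the function nevertheless agrees with
  -- the expression in the single frame chosen at `x`.
  smooth x := by
    have hx := s.mem_frameAt x
    exact ((s.contMDiffOn_codiff _ a).congr fun y hy => codiff_frameAt a hy).contMDiffAt
      ((s.isOpen_U _).mem_nhds hx)

/-- The bilinear form with given components in a frame. -/
def bilinOfComponents (s : SpinStructure.{u, v} g) (i : s.ι) (x : X) (C : Fin 4 → Fin 4 → ℂ) :
    TangentSpace (𝓡 4) x →L[ℝ] TangentSpace (𝓡 4) x →L[ℝ] ℂ :=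
  ∑ b, ∑ c, (g.inner x (s.frame i b x)).smulRight
    ((g.inner x (s.frame i c x)).smulRight (C b c))

theorem bilinOfComponents_apply {i : s.ι} {x : X} (C : Fin 4 → Fin 4 → ℂ)
    (w w' : TangentSpace (𝓡 4) x) :
    s.bilinOfComponents i x C w w' =
      ∑ b, ∑ c, (g.inner x (s.frame i b x) w * g.inner x (s.frame i c x) w') • C b c := by
  simp only [bilinOfComponents, sum_apply, ContinuousLinearMap.smulRight_apply, smul_apply,
    smul_smul]

theorem inner_frame_trans {i j : s.ι} {x : X} (hx : x ∈ s.U i ∩ s.U j) (b β : Fin 4) :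
    g.inner x (s.frame i b x) (s.frame j β x) = rotation (s.trans i j x) b β := by
  rw [g.symm, s.frame_trans i j x hx, s.inner_sum_smul_frame hx.1]

/-- Frame independence of the form built pointwise from arbitrary frames: evaluating it on another
frame produces the rotation coefficients, and `curvatureComponent_trans` does the rest. -/
theorem components₂_bilinOfComponents (i : s.ι) {x : X} (hx : x ∈ s.U i) :
    s.components₂ i (fun y => s.bilinOfComponents (s.frameAt y) y
      (s.curvatureComponent ψ a (s.frameAt y) y)) x = s.curvatureComponent ψ a i x := by
  funext α β
  simp only [components₂, bilinOfComponents_apply, inner_frame_trans ⟨s.mem_frameAt x, hx⟩]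
  exact (curvatureComponent_trans ψ a ⟨s.mem_frameAt x, hx⟩ α β).symm

/-- The form `d⁺a - ρ⁻¹(μ(ψ))`. -/
def curvatureForm : s.ImSelfDualForm where
  toFun x := s.bilinOfComponents (s.frameAt x) x (s.curvatureComponent ψ a (s.frameAt x) x)
  imSelfDual i x hx := by
    rw [components₂_bilinOfComponents ψ a i hx]
    exact isImSelfDual_curvatureComponent ψ a hx
  smooth i α β := by
    refine ContMDiffOn.congr ?_ fun x hx =>
      congrFun (congrFun (components₂_bilinOfComponents ψ a i hx) α) β
    exact (contMDiffOn_selfDualPart (s.contMDiffOn_extDerivComponents i a) α β).sub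
      ((contDiff_rhoInv_mu α β).contMDiff.comp_contMDiffOn (ψ.smooth i))

theorem exists_isRSSWFunctional (s : SpinStructure.{u, v} g) :
    ∃ F : s.Config → s.Range, s.IsRSSWFunctional F :=
  ⟨fun c => (spinorSection c.1 c.2, codiffFunction c.2, curvatureForm c.1 c.2),
    fun ψ a i _ hx => ⟨Set.indicator_of_mem hx _, codiff_frameAt a hx,
      components₂_bilinOfComponents ψ a i hx⟩⟩

end SpinStructure

end RSSW

end

theorem corollary2p10 {X : Type*} [TopologicalSpace X]
    [ChartedSpace (EuclideanSpace ℝ (Fin 4)) X] [IsManifold (𝓡 4) ∞ X]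
    [T2Space X] [CompactSpace X] [SimplyConnectedSpace X]
    (g : RSSW.RiemMetric X) (s : RSSW.SpinStructure g) :
    (∃! F : s.Config → s.Range, s.IsRSSWFunctional F) ∧
    ∀ F : s.Config → s.Range, s.IsRSSWFunctional F →
      ∀ (p : RSSW.pin2) (c : s.Config), F (p • c) = p • F c := by
  obtain ⟨F, hF⟩ := RSSW.SpinStructure.exists_isRSSWFunctional s
  exact ⟨⟨F, hF, fun F' hF' => hF'.unique hF⟩, fun F' hF' p c => hF'.map_smul p c⟩
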